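/- Let $1<p,q<\infty$ with $1/p+1/q=1$, and let $\phi:\mathbb{R}^d\times(0,\infty)\to(0,\infty)$. For a measurable function $f$ on $\mathbb{R}^d$ (real- or complex-valued) put $$\|f\|_{L_{p,\phi}}=\sup_{x\in\mathbb{R}^d,\ r>0}\frac{1}{\phi(x,r)}\left(\frac1{|B(x,r)|}\int_{B(x,r)}|f(y)|^p\,dy\right)^{1/p},$$ and let $L_{p,\phi}(\mathbb{R}^d)$ be the normed space of all such $f$ (modulo equality almost everywhere) with $\|f\|_{L_{p,\phi}}<\infty$. Assume that $\phi$ satisfies the following conditions. * ($\phi\in\mathcal{G}^{\rm dec}_p$) There is $C>0$ such that $r^{d/p}\phi(x,r)\le C s^{d/p}\phi(x,s)$ and $\phi(x,s)\le C\phi(x,r)$ for all $x\in\mathbb{R}^d$ and $0<r<s$. * (NC) There is $C>0$ such that $\frac1C\le\frac{\phi(x,r)}{\phi(y,r)}\le C$ for all $r>0$ and $x,y\in\mathbb{R}^d$ with $|x-y|\le r$. * (lim1) $\lim_{r\to+0}\inf_{x\in B(0,M)}\phi(x,r)=\infty$ for each $M>0$. * (lim2) $\lim_{r\to\infty}r^{d/p}\phi(0,r)=\infty$.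 Then $C^\infty_{\mathrm{comp}}(\mathbb{R}^d)\subset L_{p,\phi}(\mathbb{R}^d)$, and if $X$ denotes the closure of $C^\infty_{\mathrm{comp}}(\mathbb{R}^d)$ in $L_{p,\phi}(\mathbb{R}^d)$, with the norm of $L_{p,\phi}(\mathbb{R}^d)$, then $$X^{**}=L_{p,\phi}(\mathbb{R}^d)$$ with equivalent norms, in the following sense. There is a linear homeomorphism $T$ of $L_{p,\phi}(\mathbb{R}^d)$ onto $X^{**}$ such that 1. $T$ restricted to $X$ is the canonical embedding $X\to X^{**}$; 2. for every $f\in L^q(\mathbb{R}^d)$ with compact support, $fg$ is integrable for all $g\in L_{p,\phi}(\mathbb{R}^d)$, the map $\ell_f(v)=\int_{\mathbb{R}^d}fv\,dx$ is a bounded linear functional on $X$, and $(Tg)(\ell_f)=\int_{\mathbb{R}^d}fg\,dx$ for all $g\in L_{p,\phi}(\mathbb{R}^d)$. -/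

import Mathlib

open MeasureTheory Filter Topology
open scoped ENNReal ContDiff

noncomputable section

/-- The Euclidean space `ℝ^d`. -/
abbrev Eucl (d : ℕ) : Type := EuclideanSpace ℝ (Fin d)

/-! ### Conditions on the growth function

A function `φ : ℝ^d × (0,∞) → (0,∞)` is represented by `φ : Eucl d → ℝ → ℝ`; only its values
`φ x r` with `0 < r` ever matter. -/

/-- The class `𝒢_p^dec`: `φ` is positive, `r ↦ r^{d/p} φ(x,r)` is almost increasing and
`r ↦ φ(x,r)` is almost decreasing, uniformly in `x`. -/
structure GDec {d : ℕ} (p : ℝ) (φ : Eucl d → ℝ → ℝ) : Prop where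
  pos : ∀ x r, 0 < r → 0 < φ x r
  almost_mono : ∃ C : ℝ, 0 < C ∧ ∀ (x : Eucl d) (r s : ℝ), 0 < r → r < s →
    r ^ ((d : ℝ) / p) * φ x r ≤ C * (s ^ ((d : ℝ) / p) * φ x s) ∧ φ x s ≤ C * φ x r

/-- The nearness condition. -/
def Nearness {d : ℕ} (φ : Eucl d → ℝ → ℝ) : Prop :=
  ∃ C : ℝ, 0 < C ∧ ∀ (x y : Eucl d) (r : ℝ), 0 < r → dist x y ≤ r →
    1 / C ≤ φ x r / φ y r ∧ φ x r / φ y r ≤ C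

/-- `lim_{r → +0} inf_{x ∈ B(0,M)} φ(x,r) = ∞` for each `M > 0`. -/
def SmallScaleLim {d : ℕ} (φ : Eucl d → ℝ → ℝ) : Prop :=
  ∀ M : ℝ, 0 < M →
    Tendsto (fun r : ℝ => ⨅ x : Metric.ball (0 : Eucl d) M, φ x r) (𝓝[>] 0) atTop

/-- `lim_{r → ∞} r^{d/p} φ(0,r) = ∞`. -/
def LargeScaleLim {d : ℕ} (p : ℝ) (φ : Eucl d → ℝ → ℝ) : Prop :=
  Tendsto (fun r : ℝ => r ^ ((d : ℝ) / p) * φ 0 r) atTop atTop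

/-! ### The generalized Morrey space -/

/-- The mean `M_p(f, B(x,r)) = (|B|⁻¹ ∫_B |f|^p)^{1/p}`, as an extended nonnegative number. -/
def meanP {d : ℕ} {𝕜 : Type*} [RCLike 𝕜] (p : ℝ) (f : Eucl d → 𝕜) (x : Eucl d) (r : ℝ) : ℝ≥0∞ :=
  (⨍⁻ y in Metric.ball x r, ‖f y‖ₑ ^ p ∂volume) ^ (1 / p)

/-- The Morrey norm `sup_B M_p(f,B) / φ(B)`, as an extended nonnegative number. -/
def morreyENorm {d : ℕ} {𝕜 : Type*} [RCLike 𝕜] (p : ℝ) (φ : Eucl d → ℝ → ℝ)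
    (f : Eucl d → 𝕜) : ℝ≥0∞ :=
  ⨆ (x : Eucl d) (r : ℝ) (_ : 0 < r), meanP p f x r / ENNReal.ofReal (φ x r)

section facts

variable {d : ℕ} {𝕜 : Type*} [RCLike 𝕜] {p : ℝ} {φ : Eucl d → ℝ → ℝ}

theorem meanP_eq_eLpNorm' (p : ℝ) (f : Eucl d → 𝕜) (x : Eucl d) (r : ℝ) :
    meanP p f x r = eLpNorm' f p
      ((volume (Metric.ball x r))⁻¹ • (volume : Measure (Eucl d)).restrict (Metric.ball x r)) := by
  rw [meanP, setLAverage_eq', eLpNorm'_eq_lintegral_enorm]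

theorem ae_ball_of_ae {P : Eucl d → Prop} (h : ∀ᵐ y, P y) (x : Eucl d) (r : ℝ) :
    ∀ᵐ y ∂((volume (Metric.ball x r))⁻¹ •
      (volume : Measure (Eucl d)).restrict (Metric.ball x r)), P y :=
  Measure.smul_absolutelyContinuous.ae_le (ae_restrict_of_ae h)

theorem aestronglyMeasurable_ball {f : Eucl d → 𝕜} (hf : AEStronglyMeasurable f volume)
    (x : Eucl d) (r : ℝ) :
    AEStronglyMeasurable f ((volume (Metric.ball x r))⁻¹ •
      (volume : Measure (Eucl d)).restrict (Metric.ball x r)) :=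
  hf.restrict.mono_ac Measure.smul_absolutelyContinuous

theorem morreyENorm_congr {f g : Eucl d → 𝕜} (h : f =ᵐ[volume] g) :
    morreyENorm p φ f = morreyENorm p φ g := by
  unfold morreyENorm
  refine iSup_congr fun x => iSup_congr fun r => iSup_congr fun _ => ?_
  rw [meanP_eq_eLpNorm', meanP_eq_eLpNorm', eLpNorm'_congr_ae (ae_ball_of_ae h x r)]

theorem meanP_div_le_morreyENorm (f : Eucl d → 𝕜) (x : Eucl d) {r : ℝ} (hr : 0 < r) :
    meanP p f x r / ENNReal.ofReal (φ x r) ≤ morreyENorm p φ f :=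
  le_iSup_of_le x (le_iSup_of_le r (le_iSup_of_le hr le_rfl))

theorem morreyENorm_add_le (hp : 1 ≤ p) {f g : Eucl d → 𝕜}
    (hf : AEStronglyMeasurable f volume) (hg : AEStronglyMeasurable g volume) :
    morreyENorm p φ (f + g) ≤ morreyENorm p φ f + morreyENorm p φ g := by
  refine iSup_le fun x => iSup_le fun r => iSup_le fun hr => ?_
  refine le_trans ?_ (add_le_add (meanP_div_le_morreyENorm (p := p) (φ := φ) f x hr)
    (meanP_div_le_morreyENorm (p := p) (φ := φ) g x hr))
  rw [← ENNReal.add_div]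
  refine ENNReal.div_le_div_right ?_ _
  simp only [meanP_eq_eLpNorm']
  exact eLpNorm'_add_le (aestronglyMeasurable_ball hf x r) (aestronglyMeasurable_ball hg x r) hp

theorem morreyENorm_smul (hp : 1 ≤ p) (c : 𝕜) (f : Eucl d → 𝕜) :
    morreyENorm p φ (c • f) = ‖c‖ₑ * morreyENorm p φ f := by
  unfold morreyENorm
  simp only [ENNReal.mul_iSup]
  refine iSup_congr fun x => iSup_congr fun r => iSup_congr fun _ => ?_
  rw [meanP_eq_eLpNorm', meanP_eq_eLpNorm', eLpNorm'_const_smul c (by linarith), mul_div_assoc]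

theorem morreyENorm_zero (hp : 1 ≤ p) : morreyENorm p φ (0 : Eucl d → 𝕜) = 0 := by
  have h := morreyENorm_smul (φ := φ) hp (0 : 𝕜) (0 : Eucl d → 𝕜)
  simpa using h

theorem ae_eq_zero_of_morreyENorm (hp : 1 ≤ p) {f : Eucl d → 𝕜}
    (hf : AEStronglyMeasurable f volume) (h : morreyENorm p φ f = 0) : f =ᵐ[volume] 0 := by
  have key : ∀ n : ℕ, ∀ᵐ y ∂(volume : Measure (Eucl d)).restrict
      (Metric.ball (0 : Eucl d) ((n : ℝ) + 1)), f y = 0 := by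
    intro n
    have hr : (0 : ℝ) < (n : ℝ) + 1 := by positivity
    have h1 : meanP p f 0 ((n : ℝ) + 1) / ENNReal.ofReal (φ 0 ((n : ℝ) + 1)) = 0 :=
      le_antisymm (h ▸ meanP_div_le_morreyENorm f 0 hr) zero_le
    have h2 : meanP p f 0 ((n : ℝ) + 1) = 0 := by
      rcases ENNReal.div_eq_zero_iff.1 h1 with h2 | h2
      · exact h2
      · exact absurd h2 ENNReal.ofReal_ne_top
    rw [meanP_eq_eLpNorm'] at h2
    have h3 := (eLpNorm'_eq_zero_iff (by linarith) (aestronglyMeasurable_ball hf _ _)).1 h2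
    have hne : (volume (Metric.ball (0 : Eucl d) ((n : ℝ) + 1)))⁻¹ ≠ 0 :=
      ENNReal.inv_ne_zero.2 measure_ball_lt_top.ne
    exact (Measure.ae_ennreal_smul_measure_iff hne).1 h3
  have hU : (⋃ n : ℕ, Metric.ball (0 : Eucl d) ((n : ℝ) + 1)) = Set.univ := by
    refine Set.eq_univ_of_forall fun y => ?_
    obtain ⟨n, hn⟩ := exists_nat_gt (dist y 0)
    exact Set.mem_iUnion.2 ⟨n, Metric.mem_ball.2 (by linarith)⟩
  have h4 := (ae_restrict_iUnion_iff _ (fun y => f y = 0)).2 key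
  rw [hU, Measure.restrict_univ] at h4
  exact h4

end facts

/-- The measurable functions `f` (modulo a.e. equality) with `sup_B M_p(f,B) / φ(B) < ∞`. -/
def morreySubmodule {d : ℕ} (𝕜 : Type*) [RCLike 𝕜] (p : ℝ) [hp : Fact (1 ≤ p)]
    (φ : Eucl d → ℝ → ℝ) : Submodule 𝕜 (Eucl d →ₘ[volume] 𝕜) where
  carrier := {f | morreyENorm p φ f < ⊤}
  zero_mem' := by
    rw [Set.mem_ofPred_eq, morreyENorm_congr AEEqFun.coeFn_zero, morreyENorm_zero hp.out]
    exact ENNReal.zero_lt_top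
  add_mem' := by
    intro f g hf hg
    rw [Set.mem_ofPred_eq, morreyENorm_congr (AEEqFun.coeFn_add f g)]
    exact (morreyENorm_add_le hp.out f.aestronglyMeasurable g.aestronglyMeasurable).trans_lt
      (ENNReal.add_lt_top.2 ⟨hf, hg⟩)
  smul_mem' := by
    intro c f hf
    rw [Set.mem_ofPred_eq, morreyENorm_congr (AEEqFun.coeFn_smul c f), morreyENorm_smul hp.out]
    exact ENNReal.mul_lt_top enorm_lt_top hf

/-- The generalized Morrey space `L_{p,φ}(ℝ^d)`, with the pointwise operations and, below, the
norm `‖f‖ = sup_B M_p(f,B) / φ(B)`. -/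
def MorreySpace {d : ℕ} (𝕜 : Type*) [RCLike 𝕜] (p : ℝ) [Fact (1 ≤ p)]
    (φ : Eucl d → ℝ → ℝ) : Type _ := ↥(morreySubmodule 𝕜 p φ)

namespace MorreySpace

variable {d : ℕ} {𝕜 : Type*} [RCLike 𝕜] {p : ℝ} [hp : Fact (1 ≤ p)] {φ : Eucl d → ℝ → ℝ}

/-- The underlying class of functions modulo a.e. equality. -/
def toAEEqFun (f : MorreySpace 𝕜 p φ) : Eucl d →ₘ[volume] 𝕜 := Subtype.val f

instance instCoeFun : CoeFun (MorreySpace 𝕜 p φ) (fun _ => Eucl d → 𝕜) where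
  coe f := (f.toAEEqFun : Eucl d → 𝕜)

theorem morreyENorm_lt_top (f : MorreySpace 𝕜 p φ) : morreyENorm p φ f < ⊤ := f.2

theorem toReal_smul (c : 𝕜) (f : ↥(morreySubmodule 𝕜 p φ)) :
    (morreyENorm p φ ((c • f : ↥(morreySubmodule 𝕜 p φ)) : Eucl d →ₘ[volume] 𝕜)).toReal =
      ‖c‖ * (morreyENorm p φ (f : Eucl d →ₘ[volume] 𝕜)).toReal := by
  rw [Submodule.coe_smul, morreyENorm_congr (AEEqFun.coeFn_smul c _),
    morreyENorm_smul hp.out, ENNReal.toReal_mul, toReal_enorm]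

/-- The Morrey norm as a norm on the additive group of the submodule. -/
def normAux : AddGroupNorm ↥(morreySubmodule 𝕜 p φ) where
  toFun f := (morreyENorm p φ (f : Eucl d →ₘ[volume] 𝕜)).toReal
  map_zero' := by
    have h := toReal_smul (0 : 𝕜) (0 : ↥(morreySubmodule 𝕜 p φ))
    rwa [smul_zero, norm_zero, zero_mul] at h
  add_le' f g := by
    have hf : morreyENorm p φ (f : Eucl d →ₘ[volume] 𝕜) ≠ ⊤ := ne_of_lt f.2
    have hg : morreyENorm p φ (g : Eucl d →ₘ[volume] 𝕜) ≠ ⊤ := ne_of_lt g.2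
    rw [Submodule.coe_add, morreyENorm_congr (AEEqFun.coeFn_add _ _), ← ENNReal.toReal_add hf hg]
    exact ENNReal.toReal_mono (ENNReal.add_ne_top.2 ⟨hf, hg⟩)
      (morreyENorm_add_le hp.out f.1.aestronglyMeasurable g.1.aestronglyMeasurable)
  neg' f := by
    have h := toReal_smul (-1 : 𝕜) f
    have e : (-1 : 𝕜) • f = -f := Subtype.ext (neg_one_smul 𝕜 (f : Eucl d →ₘ[volume] 𝕜))
    rwa [e, norm_neg, norm_one, one_mul] at h
  eq_zero_of_map_eq_zero' f h := by
    have hf : morreyENorm p φ (f : Eucl d →ₘ[volume] 𝕜) ≠ ⊤ := ne_of_lt f.2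
    have h0 : morreyENorm p φ (f : Eucl d →ₘ[volume] 𝕜) = 0 :=
      ((ENNReal.toReal_eq_zero_iff _).1 h).resolve_right hf
    have h1 := ae_eq_zero_of_morreyENorm hp.out f.1.aestronglyMeasurable h0
    exact Subtype.ext (AEEqFun.ext (h1.trans AEEqFun.coeFn_zero.symm))

instance instNormedAddCommGroup : NormedAddCommGroup (MorreySpace 𝕜 p φ) :=
  AddGroupNorm.toNormedAddCommGroup (E := ↥(morreySubmodule 𝕜 p φ)) normAux

instance instModule : Module 𝕜 (MorreySpace 𝕜 p φ) :=
  Submodule.module (morreySubmodule 𝕜 p φ)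

instance instNormedSpace : NormedSpace 𝕜 (MorreySpace 𝕜 p φ) where
  norm_smul_le c f := (toReal_smul c (show ↥(morreySubmodule 𝕜 p φ) from f)).le

theorem norm_def (f : MorreySpace 𝕜 p φ) : ‖f‖ = (morreyENorm p φ f).toReal := rfl

theorem coeFn_zero : ((0 : MorreySpace 𝕜 p φ) : Eucl d → 𝕜) =ᵐ[volume] 0 :=
  AEEqFun.coeFn_zero

theorem coeFn_add (f g : MorreySpace 𝕜 p φ) :
    ((f + g : MorreySpace 𝕜 p φ) : Eucl d → 𝕜) =ᵐ[volume] f + g :=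
  AEEqFun.coeFn_add f.toAEEqFun g.toAEEqFun

theorem coeFn_smul (c : 𝕜) (f : MorreySpace 𝕜 p φ) :
    ((c • f : MorreySpace 𝕜 p φ) : Eucl d → 𝕜) =ᵐ[volume] c • (f : Eucl d → 𝕜) :=
  AEEqFun.coeFn_smul c f.toAEEqFun

end MorreySpace

/-- The elements of `L_{p,φ}(ℝ^d)` that are (classes of) functions in `C^∞_comp(ℝ^d)`. -/
def morreyTestFunctions {d : ℕ} (𝕜 : Type*) [RCLike 𝕜] (p : ℝ) [Fact (1 ≤ p)]
    (φ : Eucl d → ℝ → ℝ) : Submodule 𝕜 (MorreySpace 𝕜 p φ) where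
  carrier := {g | ∃ h : Eucl d → 𝕜, ContDiff ℝ ∞ h ∧ HasCompactSupport h ∧
    (g : Eucl d → 𝕜) =ᵐ[volume] h}
  zero_mem' := ⟨0, contDiff_const, HasCompactSupport.zero, MorreySpace.coeFn_zero⟩
  add_mem' := by
    rintro g₁ g₂ ⟨h₁, c₁, s₁, e₁⟩ ⟨h₂, c₂, s₂, e₂⟩
    exact ⟨h₁ + h₂, c₁.add c₂, s₁.add s₂, (MorreySpace.coeFn_add _ _).trans (e₁.add e₂)⟩
  smul_mem' := by
    rintro c g ⟨h, ch, sh, e⟩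
    exact ⟨c • h, contDiff_const.smul ch, sh.smul_left (f := fun _ => c),
      (MorreySpace.coeFn_smul _ _).trans (e.const_smul c)⟩

/-- The closure of `C^∞_comp(ℝ^d)` in `L_{p,φ}(ℝ^d)`, with the norm of `L_{p,φ}(ℝ^d)`. -/
def morreyClosure {d : ℕ} (𝕜 : Type*) [RCLike 𝕜] (p : ℝ) [Fact (1 ≤ p)]
    (φ : Eucl d → ℝ → ℝ) : Submodule 𝕜 (MorreySpace 𝕜 p φ) :=
  (morreyTestFunctions 𝕜 p φ).topologicalClosure

end

/-! Say that `g` in the Morrey space represents `Λ ∈ X**` if `Λ(v ↦ ∫_B u v) = ∫_B u g` for every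
ball `B` and every `u ∈ L^q` (`Represents`). The map `T` sends `g` to the functional it represents.
It is well defined, linear, onto and even isometric for the norms used here, by the three facts
below. It extends the canonical embedding because `v ∈ X`, seen in `X**`, is represented by `v`
itself.

Every `Λ` is represented (`exists_represents`). On a fixed ball, `u ↦ Λ(v ↦ ∫_B u v)` is a
functional on `L^q`, hence is given by an `L^p` function (`exists_lpPairing_eq`). These local
functions agree on overlaps and glue to some `g`. Testing on each ball with the `u` that norms `g`
there gives `‖g‖ ≤ ‖Λ‖`.

Every `g` represents some `Λ` with `‖Λ‖ ≤ ‖g‖` (`exists_represented`). Truncations of `g` in height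
and position lie in `X`, have norm at most `‖g‖`, and converge to `g` in `L^p` of each ball. A
weak-* cluster point of them in `X**` is the required `Λ`. That truncations lie in `X` is where the
limits of `φ` first enter. For bounded functions living in a fixed ball, small radii contribute
little because `φ` is large there, and the remaining radii are controlled by the `L^p` norm
(`exists_morreyENorm_le`). So mollifiers converge in the Morrey norm, even without uniform
convergence.

The represented `Λ` is unique (`eq_zero_of_represents_zero`), because the functionals `v ↦ ∫_B u v`
span a norm dense subspace of `X*`. Restrictions to the balls of a dyadic lattice determine the
Morrey norm up to a constant, and for elements of `X` their normalized `L^p` norms tend to zero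
(`tendsto_latticeOp`). Thus `X` embeds in a `c₀`-sum of `L^p` spaces. A functional on a `c₀`-sum is
a norm limit of its restrictions to finitely many coordinates, and Hahn–Banach transfers this to
`X*` (`exists_sum_comp_approx`).

The closure of the test functions enters as a normed space `X` with a linear isometry `ι` into the
Morrey space. -/

/-! ### Dominated convergence in `L^p`. -/

section LpConvergence

variable {α ι E : Type*} {m : MeasurableSpace α} {μ : Measure α} [NormedAddCommGroup E] {p : ℝ≥0∞}

/-- Dominated convergence in `L^p`. -/
theorem tendsto_eLpNorm_sub_of_dominated {l : Filter ι} [l.IsCountablyGenerated]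
    (hp0 : p ≠ 0) (hp : p ≠ ⊤)
    {F : ι → α → E} {f : α → E} {g : α → ℝ} (hF : ∀ i, AEStronglyMeasurable (F i) μ)
    (hf : AEStronglyMeasurable f μ) (hg : MemLp g p μ)
    (hFg : ∀ i, ∀ᵐ x ∂μ, ‖F i x‖ ≤ g x) (hfg : ∀ᵐ x ∂μ, ‖f x‖ ≤ g x)
    (hlim : ∀ᵐ x ∂μ, Tendsto (fun i => F i x) l (𝓝 (f x))) :
    Tendsto (fun i => eLpNorm (F i - f) p μ) l (𝓝 0) := by
  have hpos : 0 < p.toReal := ENNReal.toReal_pos hp0 hp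
  simp_rw [eLpNorm_eq_lintegral_rpow_enorm_toReal hp0 hp]
  have key : Tendsto (fun i => ∫⁻ x, ‖(F i - f) x‖ₑ ^ p.toReal ∂μ) l
      (𝓝 (∫⁻ _, 0 ∂μ)) := by
    -- Dominated convergence is applied along sequences. The general filter is needed for sums over
    -- finite subsets of `ℕ`; the integrands are dominated by `(2g)^p`.
    refine tendsto_of_seq_tendsto fun u hu => ?_
    refine tendsto_lintegral_of_dominated_convergence'
      (fun x => ‖(2 * g x : ℝ)‖ₑ ^ p.toReal) ?_ ?_ ?_ ?_
    · exact fun n => ((hF (u n)).sub hf).enorm.pow_const _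
    · intro n
      filter_upwards [hFg (u n), hfg] with x h1 h2
      refine ENNReal.rpow_le_rpow ?_ hpos.le
      rw [← ofReal_norm, ← ofReal_norm]
      refine ENNReal.ofReal_le_ofReal ?_
      calc ‖(F (u n) - f) x‖ ≤ ‖F (u n) x‖ + ‖f x‖ := norm_sub_le _ _
        _ ≤ 2 * g x := by linarith
        _ ≤ _ := Real.le_norm_self _
    · have h := (hg.const_mul (2 : ℝ)).eLpNorm_lt_top
      rw [eLpNorm_eq_lintegral_rpow_enorm_toReal hp0 hp] at h
      exact (ENNReal.rpow_lt_top_iff_of_pos (by positivity)).1 h |>.ne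
    · filter_upwards [hlim] with x hx
      have h1 : Tendsto (fun i => (F i - f) x) l (𝓝 0) := by
        simpa using hx.sub (tendsto_const_nhds (x := f x))
      have h2 : Tendsto (fun i => ‖(F i - f) x‖ₑ ^ p.toReal) l (𝓝 (‖(0 : E)‖ₑ ^ p.toReal)) :=
        (ENNReal.continuous_rpow_const.tendsto _).comp h1.enorm
      simpa [hpos, Function.comp_def] using h2.comp hu
  rw [lintegral_zero] at key
  have h3 := (ENNReal.continuous_rpow_const (y := 1 / p.toReal)).tendsto 0 |>.comp key
  simpa [Function.comp_def, hpos] using h3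

end LpConvergence

/-! ### Functionals on `c₀`-sums. -/

section C0

variable {𝕜 : Type*} [RCLike 𝕜] {I E X : Type*} [NormedAddCommGroup E] [NormedSpace 𝕜 E]
  [NormedAddCommGroup X] [NormedSpace 𝕜 X]

open scoped ZeroAtInfty Classical in
/-- The element of `C₀(I, E)` supported at the point `i` of a discrete space. -/
noncomputable def ZeroAtInftyContinuousMap.singleL (𝕜 : Type*) [RCLike 𝕜] {I E : Type*}
    [NormedAddCommGroup E] [NormedSpace 𝕜 E] [TopologicalSpace I] [DiscreteTopology I] (i : I) :
    E →L[𝕜] C₀(I, E) :=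
  LinearMap.mkContinuous
    { toFun := fun e =>
        { toFun := fun j => if j = i then e else 0
          continuous_toFun := continuous_of_discreteTopology
          zero_at_infty' := by
            rw [cocompact_eq_cofinite]
            refine tendsto_const_nhds.congr' ?_
            filter_upwards [(Set.finite_singleton i).compl_mem_cofinite] with j hj
            exact (if_neg (by simpa using hj)).symm }
      map_add' := fun a b => by
        ext j
        change (if j = i then a + b else 0) = (if j = i then a else 0) + (if j = i then b else 0)
        split_ifs <;> simp
      map_smul' := fun c a => by
        ext j
        change (if j = i then c • a else 0) = c • (if j = i then a else 0)
        split_ifs <;> simp } 1 (by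
    intro e
    rw [← ZeroAtInftyContinuousMap.norm_toBCF_eq_norm, one_mul]
    refine (BoundedContinuousFunction.norm_le (norm_nonneg _)).2 fun j => ?_
    change ‖if j = i then e else 0‖ ≤ ‖e‖
    split_ifs <;> simp)

open scoped ZeroAtInfty Classical in
theorem ZeroAtInftyContinuousMap.singleL_apply [TopologicalSpace I] [DiscreteTopology I] (i j : I)
    (e : E) : ZeroAtInftyContinuousMap.singleL 𝕜 i e j = if j = i then e else 0 := rfl

open scoped ZeroAtInfty in
theorem ZeroAtInftyContinuousMap.sum_apply' [TopologicalSpace I] (S : Finset I)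
    (f : I → C₀(I, E)) (j : I) : (∑ i ∈ S, f i) j = ∑ i ∈ S, f i j :=
  map_sum (⟨⟨fun f => f j, rfl⟩, fun _ _ => rfl⟩ : C₀(I, E) →+ E) f S

/-- Two scalars can be aligned by a rotation of the second one. -/
theorem exists_norm_add_mul_eq (a b : 𝕜) : ∃ c : 𝕜, ‖c‖ ≤ 1 ∧ ‖a + c * b‖ = ‖a‖ + ‖b‖ := by
  rcases eq_or_ne a 0 with rfl | ha
  · exact ⟨1, by simp, by simp⟩
  rcases eq_or_ne b 0 with rfl | hb
  · exact ⟨0, by simp, by simp⟩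
  have ha' : ‖a‖ ≠ 0 := norm_ne_zero_iff.2 ha
  have hb' : ‖b‖ ≠ 0 := norm_ne_zero_iff.2 hb
  have ha2 : ((‖a‖ : ℝ) : 𝕜) ≠ 0 := by exact_mod_cast ha'
  refine ⟨a / (‖a‖ : 𝕜) * ((‖b‖ : 𝕜) / b), ?_, ?_⟩
  · simp [ha', hb']
  · have : a + a / (‖a‖ : 𝕜) * ((‖b‖ : 𝕜) / b) * b = a * ((1 + ‖b‖ / ‖a‖ : ℝ) : 𝕜) := by
      push_cast
      field_simp
    rw [this, norm_mul, RCLike.norm_ofReal, abs_of_nonneg (by positivity)]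
    field_simp

open scoped ZeroAtInfty in
theorem ZeroAtInftyContinuousMap.norm_apply_le [TopologicalSpace I] (f : C₀(I, E)) (i : I) :
    ‖f i‖ ≤ ‖f‖ := by
  rw [← ZeroAtInftyContinuousMap.norm_toBCF_eq_norm]
  exact f.toBCF.norm_coe_le_norm i

open scoped ZeroAtInfty in
theorem ZeroAtInftyContinuousMap.norm_le_of_forall [TopologicalSpace I] (f : C₀(I, E)) {C : ℝ}
    (hC : 0 ≤ C) (h : ∀ i, ‖f i‖ ≤ C) : ‖f‖ ≤ C := by
  rw [← ZeroAtInftyContinuousMap.norm_toBCF_eq_norm]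
  exact (BoundedContinuousFunction.norm_le hC).2 h

open scoped ZeroAtInfty in
/-- A functional on `C₀(I, E)`, `I` discrete, is small on the functions vanishing on a suitable
finite set. -/
theorem ZeroAtInftyContinuousMap.exists_finset_forall_norm_le [TopologicalSpace I]
    [DiscreteTopology I] (L : StrongDual 𝕜 C₀(I, E)) {ε : ℝ} (hε : 0 < ε) :
    ∃ S : Finset I, ∀ g : C₀(I, E), (∀ i ∈ S, g i = 0) → ‖L g‖ ≤ ε * ‖g‖ := by
  -- Let `f` in the unit ball norm `L` up to `δ`, and let `S` be the finite set where `‖f i‖ ≥ δ`. A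
  -- `g` in the unit ball vanishing on `S` can be added to `f`, suitably rotated, with the norm
  -- staying below `1 + δ`. Hence `‖L f‖ + ‖L g‖ ≤ (1 + δ)‖L‖`, so `‖L g‖ ≤ δ + δ‖L‖`.
  obtain ⟨δ, hδ, hδε⟩ : ∃ δ : ℝ, 0 < δ ∧ δ + δ * ‖L‖ ≤ ε := by
    refine ⟨ε / (1 + ‖L‖), by positivity, le_of_eq ?_⟩
    have : 1 + ‖L‖ ≠ 0 := by positivity
    field_simp
  obtain ⟨f, hf1, hfL⟩ : ∃ f : C₀(I, E), ‖f‖ ≤ 1 ∧ ‖L‖ - δ < ‖L f‖ := by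
    obtain ⟨f, hf, hLf⟩ := L.exists_lt_apply_of_lt_opNorm (sub_lt_self ‖L‖ hδ)
    exact ⟨f, hf.le, hLf⟩
  have hfin : {i | δ ≤ ‖f i‖}.Finite := by
    have h := f.zero_at_infty'
    rw [cocompact_eq_cofinite] at h
    have h2 := (tendsto_zero_iff_norm_tendsto_zero.1 h).eventually (gt_mem_nhds hδ)
    simpa [Filter.eventually_cofinite] using h2
  refine ⟨hfin.toFinset, ?_⟩
  have unit : ∀ g : C₀(I, E), (∀ i ∈ hfin.toFinset, g i = 0) → ‖g‖ ≤ 1 → ‖L g‖ ≤ ε := by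
    intro g hg hg1
    obtain ⟨c, hc, hcL⟩ : ∃ c : 𝕜, ‖c‖ ≤ 1 ∧ ‖L f + c * L g‖ = ‖L f‖ + ‖L g‖ :=
      exists_norm_add_mul_eq _ _
    have h1 : ‖f + c • g‖ ≤ 1 + δ := by
      refine norm_le_of_forall _ (by positivity) fun i => ?_
      rw [add_apply, smul_apply]
      by_cases hi : i ∈ hfin.toFinset
      · rw [hg i hi, smul_zero, add_zero]
        linarith [norm_apply_le f i]
      · have : ‖f i‖ < δ := by simpa using hi
        have h3 : ‖c • g i‖ ≤ 1 := by
          rw [norm_smul]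
          exact mul_le_one₀ hc (norm_nonneg _) ((norm_apply_le g i).trans hg1)
        linarith [norm_add_le (f i) (c • g i)]
    have h2 := L.le_opNorm (f + c • g)
    rw [map_add, map_smul, smul_eq_mul, hcL] at h2
    have h3 := mul_le_mul_of_nonneg_left h1 (norm_nonneg L)
    nlinarith
  intro g hg
  by_cases h0 : ‖g‖ = 0
  · have : g = 0 := norm_eq_zero.1 h0
    simp [this]
  · have hgpos : 0 < ‖g‖ := lt_of_le_of_ne (norm_nonneg _) (Ne.symm h0)
    have h1 := unit (((‖g‖⁻¹ : ℝ) : 𝕜) • g) (fun i hi => by rw [smul_apply, hg i hi, smul_zero])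
      (by rw [norm_smul, RCLike.norm_ofReal, abs_of_pos (by positivity)]
          exact (inv_mul_cancel₀ h0).le)
    rw [map_smul, norm_smul, RCLike.norm_ofReal, abs_of_pos (by positivity),
      inv_mul_le_iff₀ hgpos] at h1
    linarith

open scoped ZeroAtInfty in
/-- If a normed space embeds into a `c₀`-sum through operators `A i`, each functional is a norm
limit of finite sums of functionals factoring through the `A i`. -/
theorem exists_sum_comp_approx (A : I → X →L[𝕜] E) (C : ℝ)
    (hC : ∀ i v, ‖A i v‖ ≤ C * ‖v‖) (hlim : ∀ v, Tendsto (fun i => A i v) cofinite (𝓝 0))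
    (K : ℝ) (hK : ∀ (v : X) (a : ℝ), 0 ≤ a → (∀ i, ‖A i v‖ ≤ a) → ‖v‖ ≤ K * a)
    (ℓ : StrongDual 𝕜 X) {ε : ℝ} (hε : 0 < ε) :
    ∃ (S : Finset I) (lam : I → StrongDual 𝕜 E), ‖ℓ - ∑ i ∈ S, (lam i).comp (A i)‖ ≤ ε := by
  -- With the discrete topology, `C₀(I, E)` is the `c₀`-sum: the cocompact filter is the cofinite
  -- one.
  let : TopologicalSpace I := ⊥
  have : DiscreteTopology I := ⟨rfl⟩
  let J₀ : X →ₗ[𝕜] C₀(I, E) :=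
    { toFun := fun v =>
        { toFun := fun i => A i v
          continuous_toFun := continuous_of_discreteTopology
          zero_at_infty' := by rw [cocompact_eq_cofinite]; exact hlim v }
      map_add' := fun a b => by ext i; exact (A i).map_add a b
      map_smul' := fun c a => by ext i; exact (A i).map_smul c a }
  have hJ : ∀ v i, J₀ v i = A i v := fun v i => rfl
  have hJb : ∀ v, ‖J₀ v‖ ≤ |C| * ‖v‖ := fun v =>
    ZeroAtInftyContinuousMap.norm_le_of_forall _ (by positivity) fun i => by
      rw [hJ]; exact (hC i v).trans (by gcongr; exact le_abs_self C)
  have hJK : ∀ v, ‖v‖ ≤ K * ‖J₀ v‖ := fun v => hK v _ (norm_nonneg _) fun i => by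
    rw [← hJ]; exact ZeroAtInftyContinuousMap.norm_apply_le _ i
  have hinj : Function.Injective J₀ := by
    rw [← LinearMap.ker_eq_bot, LinearMap.ker_eq_bot']
    intro v hv
    have := hJK v
    rw [hv, norm_zero, mul_zero] at this
    exact norm_le_zero_iff.1 this
  let e := LinearEquiv.ofInjective J₀ hinj
  -- The lower bound `‖v‖ ≤ K ‖J₀ v‖` makes `ℓ ∘ J₀⁻¹` bounded on the range of `J₀`; Hahn–Banach
  -- then extends it to the whole `c₀`-sum.
  let L₀ : StrongDual 𝕜 (LinearMap.range J₀) :=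
    LinearMap.mkContinuous (ℓ.toLinearMap.comp e.symm.toLinearMap) (‖ℓ‖ * K) (by
      intro y
      obtain ⟨v, rfl⟩ := e.surjective y
      have h1 := ℓ.le_opNorm v
      have h2 := mul_le_mul_of_nonneg_left (hJK v) (norm_nonneg ℓ)
      have h3 : ‖e v‖ = ‖J₀ v‖ := rfl
      simp only [LinearMap.comp_apply, LinearEquiv.coe_coe, LinearEquiv.symm_apply_apply,
        ContinuousLinearMap.coe_coe, h3]
      linarith)
  obtain ⟨L, hL, -⟩ := exists_extension_norm_eq (LinearMap.range J₀) L₀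
  have hLJ : ∀ v, L (J₀ v) = ℓ v := by
    intro v
    have h1 := hL (e v)
    have h2 : L₀ (e v) = ℓ v := by
      change ℓ (e.symm (e v)) = ℓ v
      rw [e.symm_apply_apply]
    rw [← h2, ← h1]; rfl
  -- The part of `J₀ v` off `S` has norm at most `|C| ‖v‖`, hence the division by `|C| + 1`; the `1`
  -- keeps the denominator positive.
  obtain ⟨S, hS⟩ := ZeroAtInftyContinuousMap.exists_finset_forall_norm_le L
    (ε := ε / (|C| + 1)) (by positivity)
  refine ⟨S, fun i => L.comp (ZeroAtInftyContinuousMap.singleL 𝕜 i), ?_⟩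
  refine ContinuousLinearMap.opNorm_le_bound _ hε.le fun v => ?_
  set g : C₀(I, E) := J₀ v - ∑ i ∈ S, ZeroAtInftyContinuousMap.singleL 𝕜 i (A i v) with hg
  classical
  have hsum : ∀ j, (∑ i ∈ S, ZeroAtInftyContinuousMap.singleL 𝕜 i (A i v)) j =
      if j ∈ S then A j v else 0 := by
    intro j
    rw [ZeroAtInftyContinuousMap.sum_apply']
    simp only [ZeroAtInftyContinuousMap.singleL_apply]
    simp
  have hg0 : ∀ i ∈ S, g i = 0 := fun i hi => by
    rw [hg, ZeroAtInftyContinuousMap.sub_apply, hsum, if_pos hi, hJ, sub_self]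
  have hgn : ‖g‖ ≤ |C| * ‖v‖ := by
    refine ZeroAtInftyContinuousMap.norm_le_of_forall _ (by positivity) fun i => ?_
    by_cases hi : i ∈ S
    · rw [hg0 i hi, norm_zero]; positivity
    · rw [hg, ZeroAtInftyContinuousMap.sub_apply, hsum, if_neg hi, sub_zero]
      exact (ZeroAtInftyContinuousMap.norm_apply_le _ i).trans (hJb v)
  have hLg : (ℓ - ∑ i ∈ S, (L.comp (ZeroAtInftyContinuousMap.singleL 𝕜 i)).comp (A i)) v
      = L g := by
    rw [hg, map_sub, hLJ, map_sum]
    simp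
  rw [hLg]
  refine (hS g hg0).trans ?_
  calc ε / (|C| + 1) * ‖g‖ ≤ ε / (|C| + 1) * (|C| * ‖v‖) := by gcongr
    _ = ε * ‖v‖ * (|C| / (|C| + 1)) := by ring
    _ ≤ ε * ‖v‖ * 1 := by gcongr; exact (div_le_one (by positivity)).2 (by linarith)
    _ = ε * ‖v‖ := mul_one _

end C0

/-! ### Functionals on `L^p` as integrals, via Radon–Nikodym. -/

section LpDual

variable {α : Type*} {m : MeasurableSpace α} {μ : Measure α} {𝕜 : Type*} [RCLike 𝕜]
  {p : ℝ≥0∞}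

theorem MeasureTheory.MemLp.toLp_eq_zero_of_ae {f : α → 𝕜} (h : MemLp f p μ) (h0 : f =ᵐ[μ] 0) :
    h.toLp f = 0 :=
  (MemLp.toLp_congr h MemLp.zero h0).trans (MemLp.toLp_zero _)

/-- On a σ-finite measure space there is a positive function in `L^p`. -/
theorem exists_pos_memLp [SigmaFinite μ] (hp0 : p ≠ 0) (hp : p ≠ ⊤) :
    ∃ θ : α → ℝ, Measurable θ ∧ (∀ x, 0 < θ x) ∧ MemLp θ p μ := by
  obtain ⟨g, hg0, hgm, hg⟩ := exists_pos_lintegral_lt_of_sigmaFinite μ one_ne_zero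
  have hpos : 0 < p.toReal := ENNReal.toReal_pos hp0 hp
  have hm : Measurable fun x => (g x : ℝ) ^ (1 / p.toReal) := hgm.coe_nnreal_real.pow_const _
  refine ⟨fun x => (g x : ℝ) ^ (1 / p.toReal), hm, fun x => ?_, hm.aestronglyMeasurable, ?_⟩
  · exact Real.rpow_pos_of_pos (by exact_mod_cast hg0 x) _
  · rw [eLpNorm_lt_top_iff_lintegral_rpow_enorm_lt_top hp0 hp]
    refine lt_of_eq_of_lt (lintegral_congr fun x => ?_) (hg.trans ENNReal.one_lt_top)
    rw [Real.enorm_eq_ofReal (by positivity), ENNReal.ofReal_rpow_of_nonneg (by positivity) hpos.le,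
      ← Real.rpow_mul (by positivity), one_div_mul_cancel hpos.ne', Real.rpow_one,
      ENNReal.ofReal_coe_nnreal]

variable [Fact (1 ≤ p)]

/-- Countable additivity of `E ↦ 1_E θ` as an `L^p`-valued set function. -/
theorem hasSum_toLp_indicator (hp : p ≠ ⊤) {θ : α → 𝕜} (hθ : MemLp θ p μ) {f : ℕ → Set α}
    (hf : ∀ i, MeasurableSet (f i)) (hd : Pairwise (Function.onFun Disjoint f)) :
    HasSum (fun i => (hθ.indicator (hf i)).toLp _)
      ((hθ.indicator (MeasurableSet.iUnion hf)).toLp _) := by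
  have hp0 : p ≠ 0 := (zero_lt_one.trans_le (Fact.out : 1 ≤ p)).ne'
  have hm : ∀ S : Finset ℕ, MeasurableSet (⋃ i ∈ S, f i) := fun S =>
    S.measurableSet_biUnion fun i _ => hf i
  have hS : ∀ S : Finset ℕ, ∑ i ∈ S, (hθ.indicator (hf i)).toLp _ =
      (hθ.indicator (hm S)).toLp _ := by
    intro S
    induction S using Finset.induction_on with
    | empty =>
      rw [Finset.sum_empty, MemLp.toLp_eq_zero_of_ae _ (by simp; rfl)]
    | insert a S ha ih =>
      rw [Finset.sum_insert ha, ih, ← MemLp.toLp_add]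
      refine MemLp.toLp_congr _ _ (Eventually.of_forall fun x => ?_)
      rw [Finset.set_biUnion_insert, Set.indicator_union_of_disjoint]
      · rfl
      rw [Set.disjoint_iUnion₂_right]
      exact fun i hi => hd (fun h => ha (h ▸ hi))
  rw [HasSum, SummationFilter.unconditional_filter]
  simp_rw [hS]
  rw [Lp.tendsto_Lp_iff_tendsto_eLpNorm'']
  refine tendsto_eLpNorm_sub_of_dominated hp0 hp (fun S => (hθ.indicator (hm S)).1)
    (hθ.indicator (MeasurableSet.iUnion hf)).1 hθ.norm
    (fun S => Eventually.of_forall fun x => norm_indicator_le_norm_self _ _)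
    (Eventually.of_forall fun x => norm_indicator_le_norm_self _ _)
    (Eventually.of_forall fun x => ?_)
  refine tendsto_const_nhds.congr' ?_
  by_cases hx : ∃ i, x ∈ f i
  · obtain ⟨i, hi⟩ := hx
    filter_upwards [eventually_ge_atTop {i}] with S hS
    rw [Set.indicator_of_mem (Set.mem_iUnion.2 ⟨i, hi⟩),
      Set.indicator_of_mem (Set.mem_iUnion₂.2 ⟨i, by simpa using hS, hi⟩)]
  · push Not at hx
    filter_upwards with S
    rw [Set.indicator_of_notMem (by simpa using hx), Set.indicator_of_notMem (by simp [hx])]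

open scoped Classical in
/-- The signed measure `E ↦ Ψ (1_E θ)`. -/
noncomputable def signedMeasureOfLp (hp : p ≠ ⊤) {θ : α → 𝕜} (hθ : MemLp θ p μ)
    (Ψ : Lp 𝕜 p μ →L[ℝ] ℝ) : SignedMeasure α where
  measureOf' E := if h : MeasurableSet E then Ψ ((hθ.indicator h).toLp _) else 0
  empty' := by
    rw [dif_pos MeasurableSet.empty, MemLp.toLp_eq_zero_of_ae _ (by simp; rfl), map_zero]
  not_measurable' E h := dif_neg h
  m_iUnion' f hf hd := by
    rw [dif_pos (MeasurableSet.iUnion hf)]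
    simp_rw [dif_pos (hf _)]
    exact (hasSum_toLp_indicator hp hθ hf hd).mapL Ψ

/-- Radon–Nikodym for the signed measure `E ↦ Ψ(1_E θ)`, which vanishes on null sets. The factor `θ
∈ L^p` makes this defined for every measurable `E`, also when `μ E = ∞`. -/
theorem exists_integral_eq_real [SigmaFinite μ] (hp : p ≠ ⊤) {θ : α → 𝕜} (hθ : MemLp θ p μ)
    (Ψ : Lp 𝕜 p μ →L[ℝ] ℝ) : ∃ w : α → ℝ, Measurable w ∧ Integrable w μ ∧
      ∀ (E : Set α) (hE : MeasurableSet E), Ψ ((hθ.indicator hE).toLp _) = ∫ x in E, w x ∂μ := by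
  set s := signedMeasureOfLp hp hθ Ψ with hs
  have hsE : ∀ (E : Set α) (hE : MeasurableSet E), s E = Ψ ((hθ.indicator hE).toLp _) :=
    fun E hE => dif_pos hE
  have hac : s ≪ᵥ μ.toENNRealVectorMeasure := by
    refine VectorMeasure.AbsolutelyContinuous.mk fun E hE h0 => ?_
    rw [Measure.toENNRealVectorMeasure_apply_measurable hE] at h0
    rw [hsE E hE, MemLp.toLp_eq_zero_of_ae, map_zero]
    filter_upwards [measure_eq_zero_iff_ae_notMem.1 h0] with x hx
    exact Set.indicator_of_notMem hx _
  have h := SignedMeasure.withDensityᵥ_rnDeriv_eq s μ hac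
  refine ⟨s.rnDeriv μ, SignedMeasure.measurable_rnDeriv s μ, SignedMeasure.integrable_rnDeriv s μ,
    fun E hE => ?_⟩
  rw [← hsE E hE, ← withDensityᵥ_apply (SignedMeasure.integrable_rnDeriv s μ) hE, h]

/-- The real case is applied separately to the real and imaginary parts of `Φ`. -/
theorem exists_integral_eq [SigmaFinite μ] (hp : p ≠ ⊤) {θ : α → 𝕜} (hθ : MemLp θ p μ)
    (Φ : StrongDual 𝕜 (Lp 𝕜 p μ)) : ∃ w : α → 𝕜, Measurable w ∧ Integrable w μ ∧
      ∀ (E : Set α) (hE : MeasurableSet E), Φ ((hθ.indicator hE).toLp _) = ∫ x in E, w x ∂μ := by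
  obtain ⟨a, ham, hai, ha⟩ := exists_integral_eq_real hp hθ
    ((RCLike.reCLM (K := 𝕜)).comp (Φ.restrictScalars ℝ))
  obtain ⟨b, hbm, hbi, hb⟩ := exists_integral_eq_real hp hθ
    ((RCLike.imCLM (K := 𝕜)).comp (Φ.restrictScalars ℝ))
  refine ⟨fun x => (a x : 𝕜) + (b x : 𝕜) * RCLike.I, ?_, ?_, fun E hE => ?_⟩
  · exact (RCLike.measurable_ofReal.comp ham).add ((RCLike.measurable_ofReal.comp hbm).mul_const _)
  · exact hai.ofReal.add (hbi.ofReal.mul_const _)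
  · have h1 : Integrable (fun x => (a x : 𝕜)) (μ.restrict E) := hai.ofReal.integrableOn
    have h2 : Integrable (fun x => (b x : 𝕜) * RCLike.I) (μ.restrict E) :=
      (hbi.ofReal.mul_const _).integrableOn
    rw [integral_add h1 h2, integral_mul_const, integral_ofReal, integral_ofReal, ← ha E hE,
      ← hb E hE]
    exact (RCLike.re_add_im _).symm

/-- Linearity passes from indicators to simple functions. Bounded simple approximations of `s` then
converge on both sides: `θ s` in `L^p` by domination with `K|θ|`, and the integrals by domination
with `K|w|`. -/
theorem exists_forall_bounded_eq_integral [SigmaFinite μ] (hp : p ≠ ⊤) {θ : α → 𝕜}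
    (hθ : MemLp θ p μ) (Φ : StrongDual 𝕜 (Lp 𝕜 p μ)) : ∃ w : α → 𝕜, Measurable w ∧
      Integrable w μ ∧ ∀ (s : α → 𝕜) (K : ℝ), Measurable s → (∀ x, ‖s x‖ ≤ K) →
        ∀ h : MemLp (fun x => θ x * s x) p μ, Φ (h.toLp _) = ∫ x, w x * s x ∂μ := by
  have hp0 : p ≠ 0 := (zero_lt_one.trans_le (Fact.out : 1 ≤ p)).ne'
  obtain ⟨w, hwm, hwi, hw⟩ := exists_integral_eq hp hθ Φ
  have mem : ∀ (s : α → 𝕜) (K : ℝ), Measurable s → (∀ x, ‖s x‖ ≤ K) →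
      MemLp (fun x => θ x * s x) p μ := fun s K hs hK =>
    (hθ.norm.const_mul K).mono (hθ.1.mul hs.aestronglyMeasurable) (Eventually.of_forall fun x => by
      rw [norm_mul, Real.norm_eq_abs, mul_comm]
      exact (mul_le_mul_of_nonneg_right (hK x) (norm_nonneg _)).trans (le_abs_self _))
  have int : ∀ (s : α → 𝕜) (K : ℝ), Measurable s → (∀ x, ‖s x‖ ≤ K) →
      Integrable (fun x => w x * s x) μ := fun s K hs hK =>
    hwi.mul_bdd (c := K) hs.aestronglyMeasurable (Eventually.of_forall hK)
  have simple : ∀ (s : SimpleFunc α 𝕜) (h : MemLp (fun x => θ x * s x) p μ),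
      Φ (h.toLp _) = ∫ x, w x * s x ∂μ := by
    intro s
    induction s using SimpleFunc.induction with
    | const c hE =>
      rename_i E
      intro h
      have h1 : h.toLp _ = c • (hθ.indicator hE).toLp _ := by
        rw [← MemLp.toLp_const_smul]
        refine MemLp.toLp_congr _ _ (Eventually.of_forall fun x => ?_)
        by_cases hx : x ∈ E <;> simp [hx, mul_comm]
      rw [h1, map_smul, hw E hE, smul_eq_mul, ← integral_indicator hE, ← integral_const_mul]
      refine integral_congr_ae (Eventually.of_forall fun x => ?_)
      by_cases hx : x ∈ E <;> simp [hx, mul_comm]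
    | add hd hf hg =>
      rename_i f g
      intro h
      obtain ⟨Kf, hKf⟩ := f.exists_forall_norm_le
      obtain ⟨Kg, hKg⟩ := g.exists_forall_norm_le
      have hf' := mem f Kf f.measurable hKf
      have hg' := mem g Kg g.measurable hKg
      have h1 : h.toLp _ = hf'.toLp _ + hg'.toLp _ := by
        rw [← MemLp.toLp_add]
        exact MemLp.toLp_congr _ _ (Eventually.of_forall fun x => by simp [mul_add])
      rw [h1, map_add, hf hf', hg hg', ← integral_add (int f Kf f.measurable hKf)
        (int g Kg g.measurable hKg)]
      simp [mul_add]
  refine ⟨w, hwm, hwi, fun s K hs hK h => ?_⟩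
  have hsm : StronglyMeasurable s := hs.stronglyMeasurable
  have hb : ∀ n x, ‖hsm.approxBounded K n x‖ ≤ K := fun n x =>
    hsm.norm_approxBounded_le ((norm_nonneg _).trans (hK x)) n x
  have hlim : ∀ x, Tendsto (fun n => hsm.approxBounded K n x) atTop (𝓝 (s x)) := fun x =>
    hsm.tendsto_approxBounded_of_norm_le (hK x)
  have hn : ∀ n, MemLp (fun x => θ x * hsm.approxBounded K n x) p μ := fun n =>
    mem _ K (hsm.approxBounded K n).measurable (hb n)
  have t1 : Tendsto (fun n => (hn n).toLp _) atTop (𝓝 (h.toLp _)) := by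
    rw [Lp.tendsto_Lp_iff_tendsto_eLpNorm'']
    refine tendsto_eLpNorm_sub_of_dominated hp0 hp (fun n => (hn n).1) h.1 (hθ.norm.mul_const K)
      (fun n => Eventually.of_forall fun x => ?_) (Eventually.of_forall fun x => ?_)
      (Eventually.of_forall fun x => (hlim x).const_mul _)
    · rw [norm_mul]; exact mul_le_mul_of_nonneg_left (hb n x) (norm_nonneg _)
    · rw [norm_mul]; exact mul_le_mul_of_nonneg_left (hK x) (norm_nonneg _)
  have t2 : Tendsto (fun n => ∫ x, w x * hsm.approxBounded K n x ∂μ) atTop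
      (𝓝 (∫ x, w x * s x ∂μ)) := by
    refine tendsto_integral_of_dominated_convergence (fun x => ‖w x‖ * K)
      (fun n => (int _ K (hsm.approxBounded K n).measurable (hb n)).1) (hwi.norm.mul_const K)
      (fun n => Eventually.of_forall fun x => ?_)
      (Eventually.of_forall fun x => (hlim x).const_mul _)
    rw [norm_mul]; exact mul_le_mul_of_nonneg_left (hb n x) (norm_nonneg _)
  refine tendsto_nhds_unique ((Φ.continuous.tendsto _).comp t1) (t2.congr fun n => ?_)
  exact (simple _ (hn n)).symm

end LpDual

/-! ### The duality between `L^p` and `L^q`. -/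

section LpDual

variable {α : Type*} {m : MeasurableSpace α} {μ : Measure α} {𝕜 : Type*} [RCLike 𝕜]

/-- The function `|v|^{q-2} \bar v` that norms `v ∈ L^q`. -/
noncomputable def dualPow (q : ℝ) (v : 𝕜) : 𝕜 := starRingEnd 𝕜 v * ((‖v‖ ^ (q - 2) : ℝ) : 𝕜)

theorem measurable_dualPow (q : ℝ) : Measurable (dualPow (𝕜 := 𝕜) q) :=
  RCLike.continuous_conj.measurable.mul
    (RCLike.measurable_ofReal.comp (measurable_norm.pow_const _))

theorem norm_dualPow {q : ℝ} (hq : 1 < q) (v : 𝕜) : ‖dualPow q v‖ = ‖v‖ ^ (q - 1) := by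
  rcases eq_or_ne v 0 with rfl | hv
  · simp [dualPow, Real.zero_rpow (sub_pos.2 hq).ne']
  · rw [dualPow, norm_mul, RCLike.norm_conj, RCLike.norm_ofReal, abs_of_nonneg (by positivity)]
    nth_rewrite 1 [← Real.rpow_one ‖v‖]
    rw [← Real.rpow_add (norm_pos_iff.2 hv)]
    congr 1; ring

theorem mul_dualPow {q : ℝ} (hq : 1 < q) (v : 𝕜) : v * dualPow q v = ((‖v‖ ^ q : ℝ) : 𝕜) := by
  rcases eq_or_ne v 0 with rfl | hv
  · simp [dualPow, Real.zero_rpow (by linarith : q ≠ 0)]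
  · rw [dualPow, ← mul_assoc, RCLike.mul_conj, ← RCLike.ofReal_pow, ← RCLike.ofReal_mul,
      ← Real.rpow_natCast, ← Real.rpow_add (norm_pos_iff.2 hv)]
    congr 2; push_cast; ring

/-- Testing `v` against `|v|^{q-2} \bar v` bounds its `L^q` norm. -/
theorem eLpNorm_le_of_integral_mul_dualPow {p q : ℝ} (hpq : p.HolderConjugate q) {v : α → 𝕜}
    (hv : AEStronglyMeasurable v μ) {C : ℝ≥0∞}
    (hfin : eLpNorm (fun x => dualPow q (v x)) (ENNReal.ofReal p) μ < ⊤)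
    (h : ‖∫ x, v x * dualPow q (v x) ∂μ‖ₑ ≤
      C * eLpNorm (fun x => dualPow q (v x)) (ENNReal.ofReal p) μ) :
    eLpNorm v (ENNReal.ofReal q) μ ≤ C := by
  have hp0 := hpq.pos
  have hq0 := hpq.symm.pos
  have hq1 : 1 < q := hpq.symm.lt
  set I := ∫⁻ x, ‖v x‖ₑ ^ q ∂μ with hI
  have hen : ∀ x, ‖dualPow q (v x)‖ₑ ^ p = ‖v x‖ₑ ^ q := by
    intro x
    rw [← ofReal_norm, ← ofReal_norm, norm_dualPow hq1, ENNReal.ofReal_rpow_of_nonneg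
      (by positivity) hp0.le, ENNReal.ofReal_rpow_of_nonneg (by positivity) hq0.le,
      ← Real.rpow_mul (norm_nonneg _), hpq.symm.sub_one_mul_conj]
  have hu : eLpNorm (fun x => dualPow q (v x)) (ENNReal.ofReal p) μ = I ^ (1 / p) := by
    rw [eLpNorm_eq_lintegral_rpow_enorm_toReal (by simpa using hp0) ENNReal.ofReal_ne_top,
      ENNReal.toReal_ofReal hp0.le]
    simp_rw [hen, hI]
  have hvq : eLpNorm v (ENNReal.ofReal q) μ = I ^ (1 / q) := by
    rw [eLpNorm_eq_lintegral_rpow_enorm_toReal (by simpa using hq0) ENNReal.ofReal_ne_top,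
      ENNReal.toReal_ofReal hq0.le]
  -- The hypothesis reads `I ≤ C · I^(1/p)`. Cancelling `I^(1/p)` to get `I^(1/q) ≤ C` requires `I`
  -- to be finite and nonzero.
  have hItop : I ≠ ⊤ := by
    rw [hu] at hfin
    exact ((ENNReal.rpow_lt_top_iff_of_pos (by positivity)).1 hfin).ne
  have hint : ‖∫ x, v x * dualPow q (v x) ∂μ‖ₑ = I := by
    simp_rw [mul_dualPow hq1]
    rw [integral_ofReal, ← ofReal_norm, RCLike.norm_ofReal,
      abs_of_nonneg (integral_nonneg fun x => by positivity),
      integral_eq_lintegral_of_nonneg_ae (Eventually.of_forall fun x => by positivity)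
        (hv.norm.aemeasurable.pow_const q).aestronglyMeasurable]
    have : ∀ x, ENNReal.ofReal (‖v x‖ ^ q) = ‖v x‖ₑ ^ q := fun x => by
      rw [← ofReal_norm, ENNReal.ofReal_rpow_of_nonneg (norm_nonneg _) hq0.le]
    simp_rw [this]
    exact ENNReal.ofReal_toReal hItop
  rw [hint, hu] at h
  rw [hvq]
  rcases eq_or_ne I 0 with h0 | h0
  · rw [h0, ENNReal.zero_rpow_of_pos (by positivity)]; exact zero_le
  · have hmul : I ^ (1 / q) * I ^ (1 / p) = I := by
      rw [← ENNReal.rpow_add _ _ h0 hItop, one_div, one_div, hpq.symm.inv_add_inv_eq_one,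
        ENNReal.rpow_one]
    have hne0 : I ^ (1 / p) ≠ 0 := by
      simp [ENNReal.rpow_eq_zero_iff, h0, hItop]
    have hnetop : I ^ (1 / p) ≠ ⊤ := ENNReal.rpow_ne_top_of_nonneg (by positivity) hItop
    exact (ENNReal.mul_le_mul_iff_left hne0 hnetop).1 (hmul.le.trans h)

variable {p q : ℝ} [Fact (1 ≤ ENNReal.ofReal p)] [Fact (1 ≤ ENNReal.ofReal q)]

/-- A functional on `L^p` is integration against a function in `L^q`. -/
theorem exists_lpPairing_eq [SigmaFinite μ]
    [ENNReal.HolderConjugate (ENNReal.ofReal q) (ENNReal.ofReal p)] (hpq : p.HolderConjugate q)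
    (Φ : StrongDual 𝕜 (Lp 𝕜 (ENNReal.ofReal p) μ)) :
    ∃ w : Lp 𝕜 (ENNReal.ofReal q) μ, ‖w‖ ≤ ‖Φ‖ ∧
      (ContinuousLinearMap.mul 𝕜 𝕜).lpPairing μ (ENNReal.ofReal q) (ENNReal.ofReal p) w = Φ := by
  have hp0 := hpq.pos
  have hq1 : 1 < q := hpq.symm.lt
  have hP0 : ENNReal.ofReal p ≠ 0 := by simpa using hp0
  obtain ⟨θ, hθm, hθ0, hθ⟩ := exists_pos_memLp (μ := μ) hP0 ENNReal.ofReal_ne_top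
  have hθ𝕜 : MemLp (fun x => (θ x : 𝕜)) (ENNReal.ofReal p) μ := hθ.ofReal
  have hθne : ∀ x, (θ x : 𝕜) ≠ 0 := fun x => by exact_mod_cast (hθ0 x).ne'
  have hθm𝕜 : Measurable fun x => (θ x : 𝕜) := RCLike.measurable_ofReal.comp hθm
  -- Since `Φ(θ s) = ∫ W s` for bounded `s`, the candidate density is `W / θ`, valid at once for all
  -- `u` with `|u| ≤ K θ`.
  obtain ⟨W, hWm, hWi, hW⟩ := exists_forall_bounded_eq_integral ENNReal.ofReal_ne_top hθ𝕜 Φ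
  set w : α → 𝕜 := fun x => W x / θ x with hw
  have hwm : Measurable w := hWm.div hθm𝕜
  -- functions dominated by a multiple of the weight
  have dom : ∀ (u : α → 𝕜) (K : ℝ), Measurable u → (∀ x, ‖u x‖ ≤ K * θ x) →
      ∃ h : MemLp u (ENNReal.ofReal p) μ, Φ (h.toLp _) = ∫ x, w x * u x ∂μ := by
    intro u K hu hK
    have hs : ∀ x, ‖u x / θ x‖ ≤ K := fun x => by
      rw [norm_div, RCLike.norm_ofReal, abs_of_pos (hθ0 x), div_le_iff₀ (hθ0 x)]
      exact hK x
    have hmem : MemLp u (ENNReal.ofReal p) μ :=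
      (hθ.const_mul K).mono hu.aestronglyMeasurable (Eventually.of_forall fun x =>
        (hK x).trans (le_abs_self _))
    have heq : (fun x => (θ x : 𝕜) * (u x / θ x)) = u := by
      funext x; field_simp [hθne x]
    refine ⟨hmem, ?_⟩
    have h1 := hW (fun x => u x / θ x) K (hu.div hθm𝕜) hs (by rw [heq]; exact hmem)
    have h2 : ∀ x, W x * (u x / θ x) = w x * u x := fun x => by
      rw [hw]; ring
    simp_rw [h2] at h1
    rw [← h1]
    congr 2
    exact heq.symm
  have bound : eLpNorm w (ENNReal.ofReal q) μ ≤ ‖Φ‖ₑ := by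
    -- On `A n` the norming function of `w` is at most `n^(q-1) ≤ n^(q-1) n θ`, so it can be
    -- inserted into `Φ`. This bounds the truncations of `w` in `L^q` by `‖Φ‖`; since the `A n`
    -- exhaust the space, the bound passes to `w`.
    set A : ℕ → Set α := fun n => {x | ‖w x‖ ≤ n ∧ 1 ≤ n * θ x} with hA
    have hAm : ∀ n, MeasurableSet (A n) := fun n =>
      (measurableSet_le hwm.norm measurable_const).inter
        (measurableSet_le measurable_const (hθm.const_mul _))
    refine Lp.eLpNorm_le_of_ae_tendsto (u := atTop) (f := fun n => (A n).indicator w)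
      (Eventually.of_forall fun n => ?_) (fun n => (hwm.indicator (hAm n)).aestronglyMeasurable)
      (Eventually.of_forall fun x => ?_)
    · set v := (A n).indicator w with hv
      have hvm : Measurable v := hwm.indicator (hAm n)
      have hb : ∀ x, ‖dualPow q (v x)‖ ≤ ((n : ℝ) ^ (q - 1) * n) * θ x := by
        intro x
        rw [norm_dualPow hq1]
        by_cases hx : x ∈ A n
        · rw [hv, Set.indicator_of_mem hx]
          calc ‖w x‖ ^ (q - 1) ≤ (n : ℝ) ^ (q - 1) :=
                Real.rpow_le_rpow (norm_nonneg _) hx.1 (by linarith)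
            _ ≤ (n : ℝ) ^ (q - 1) * (n * θ x) := le_mul_of_one_le_right (by positivity) hx.2
            _ = _ := by ring
        · rw [hv, Set.indicator_of_notMem hx, norm_zero, Real.zero_rpow (by linarith)]
          have := (hθ0 x).le
          positivity
      obtain ⟨hmem, hΦ⟩ := dom (fun x => dualPow q (v x)) _ ((measurable_dualPow q).comp hvm) hb
      refine eLpNorm_le_of_integral_mul_dualPow hpq hvm.aestronglyMeasurable hmem.2 ?_
      have hwv : ∀ x, v x * dualPow q (v x) = w x * dualPow q (v x) := by
        intro x
        by_cases hx : x ∈ A n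
        · rw [hv, Set.indicator_of_mem hx]
        · rw [hv, Set.indicator_of_notMem hx]; simp [dualPow]
      simp_rw [hwv]
      rw [← hΦ]
      refine (Φ.le_opENorm _).trans ?_
      rw [Lp.enorm_toLp]
    · refine tendsto_const_nhds.congr' ?_
      obtain ⟨N₁, h1⟩ := exists_nat_ge ‖w x‖
      obtain ⟨N₂, h2⟩ := exists_nat_ge (1 / θ x)
      filter_upwards [eventually_ge_atTop N₁, eventually_ge_atTop N₂] with n hn1 hn2
      rw [Set.indicator_of_mem]
      refine ⟨h1.trans (by exact_mod_cast hn1), ?_⟩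
      rw [← div_le_iff₀ (hθ0 x)]
      exact h2.trans (by exact_mod_cast hn2)
  have hwq : MemLp w (ENNReal.ofReal q) μ :=
    ⟨hwm.aestronglyMeasurable, bound.trans_lt enorm_lt_top⟩
  refine ⟨hwq.toLp w, ?_, ?_⟩
  · have : ‖hwq.toLp w‖ₑ ≤ ‖Φ‖ₑ := by rwa [Lp.enorm_toLp]
    exact enorm_le_iff_norm_le.1 this
  · ext u
    set Ψ := (ContinuousLinearMap.mul 𝕜 𝕜).lpPairing μ (ENNReal.ofReal q) (ENNReal.ofReal p)
      (hwq.toLp w) with hΨ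
    have hum : Measurable u := (Lp.stronglyMeasurable u).measurable
    -- Functions dominated by multiples of `θ` are dense in `L^p`, so `Φ` and the pairing, which
    -- agree on them, agree everywhere.
    set B : ℕ → Set α := fun n => {x | ‖u x‖ ≤ n * θ x} with hB
    have hBm : ∀ n, MeasurableSet (B n) := fun n =>
      measurableSet_le hum.norm (hθm.const_mul _)
    have hb : ∀ n x, ‖(B n).indicator u x‖ ≤ n * θ x := by
      intro n x
      by_cases hx : x ∈ B n
      · rw [Set.indicator_of_mem hx]; exact hx
      · rw [Set.indicator_of_notMem hx, norm_zero]
        have := (hθ0 x).le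
        positivity
    have hd := fun n => dom ((B n).indicator u) n (hum.indicator (hBm n)) (hb n)
    choose hmem hΦ using hd
    have hlim : Tendsto (fun n => (hmem n).toLp _) atTop (𝓝 u) := by
      rw [Lp.tendsto_Lp_iff_tendsto_eLpNorm']
      have h1 := tendsto_eLpNorm_sub_of_dominated (l := atTop) hP0 ENNReal.ofReal_ne_top
        (fun n => (hmem n).1) (Lp.memLp u).1 (Lp.memLp u).norm
        (fun n => Eventually.of_forall fun x => norm_indicator_le_norm_self _ _)
        (Eventually.of_forall fun x => le_rfl) (Eventually.of_forall fun x => by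
          refine tendsto_const_nhds.congr' ?_
          obtain ⟨N, hN⟩ := exists_nat_ge (‖u x‖ / θ x)
          filter_upwards [eventually_ge_atTop N] with n hn
          rw [Set.indicator_of_mem]
          change ‖u x‖ ≤ n * θ x
          rw [← div_le_iff₀ (hθ0 x)]
          exact hN.trans (by exact_mod_cast hn))
      refine h1.congr fun n => eLpNorm_congr_ae ?_
      filter_upwards [(hmem n).coeFn_toLp] with x hx
      simp [hx]
    refine tendsto_nhds_unique ((Ψ.continuous.tendsto _).comp hlim)
      (((Φ.continuous.tendsto _).comp hlim).congr fun n => ?_)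
    rw [Function.comp_apply, Function.comp_apply, hΦ n, hΨ,
      ContinuousLinearMap.lpPairing_eq_integral]
    refine integral_congr_ae ?_
    filter_upwards [(hmem n).coeFn_toLp, hwq.coeFn_toLp] with x h1 h2
    rw [h1, h2]; rfl

/-- A pairing with `L^q` that norms an element of `L^p`. -/
theorem exists_lpPairing_eq_norm [SigmaFinite μ]
    [ENNReal.HolderConjugate (ENNReal.ofReal q) (ENNReal.ofReal p)] (hpq : p.HolderConjugate q)
    (h : Lp 𝕜 (ENNReal.ofReal p) μ) :
    ∃ w : Lp 𝕜 (ENNReal.ofReal q) μ, ‖w‖ ≤ 1 ∧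
      (ContinuousLinearMap.mul 𝕜 𝕜).lpPairing μ (ENNReal.ofReal q) (ENNReal.ofReal p) w h =
        (‖h‖ : 𝕜) := by
  obtain ⟨Ψ, hΨ1, hΨ⟩ := exists_dual_vector'' 𝕜 h
  obtain ⟨w, hw, hwΨ⟩ := exists_lpPairing_eq hpq Ψ
  exact ⟨w, hw.trans hΨ1, by rw [hwΨ, hΨ]⟩

end LpDual

/-! ### Lower bounds on `φ` drawn from the limit conditions. -/

section growth

variable {d : ℕ} {p : ℝ} {φ : Eucl d → ℝ → ℝ}

/-- Lower bound of `φ` on small balls meeting a bounded set. -/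
theorem SmallScaleLim.exists_le (hφ : GDec p φ) (hlim1 : SmallScaleLim φ) (R N : ℝ) :
    ∃ δ : ℝ, 0 < δ ∧ ∀ (x : Eucl d) (r : ℝ), 0 < r → r < δ → ‖x‖ < r + R → N ≤ φ x r := by
  have h := (hlim1 (|R| + 1) (by positivity)).eventually_ge_atTop N
  obtain ⟨δ, hδ, hsub⟩ := mem_nhdsGT_iff_exists_Ioo_subset.1 h
  -- For `r < 1`, the condition `‖x‖ < r + R` places `x` in the ball of radius `|R| + 1` over which
  -- the infimum is taken.
  refine ⟨min δ 1, lt_min hδ one_pos, fun x r hr hrδ hx => ?_⟩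
  have h1 : N ≤ ⨅ x : Metric.ball (0 : Eucl d) (|R| + 1), φ x r :=
    hsub ⟨hr, hrδ.trans_le (min_le_left _ _)⟩
  have hx' : x ∈ Metric.ball (0 : Eucl d) (|R| + 1) := by
    rw [mem_ball_zero_iff]
    linarith [hrδ.trans_le (min_le_right δ 1), le_abs_self R]
  refine h1.trans (ciInf_le (f := fun y : Metric.ball (0 : Eucl d) (|R| + 1) => φ y r)
    ⟨0, ?_⟩ ⟨x, hx'⟩)
  rintro _ ⟨y, rfl⟩
  exact (hφ.pos y r hr).le

/-- Lower bound of `r^{d/p} φ` on large balls meeting a bounded set. -/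
theorem LargeScaleLim.exists_le (hφ : GDec p φ) (hNC : Nearness φ)
    (hlim2 : LargeScaleLim p φ) (R N : ℝ) :
    ∃ ρ : ℝ, 0 < ρ ∧ ∀ (x : Eucl d) (r : ℝ), ρ ≤ r → ‖x‖ < r + R →
      N ≤ r ^ ((d : ℝ) / p) * φ x r := by
  obtain ⟨C₁, hC₁, h₁⟩ := hφ.almost_mono
  obtain ⟨C₂, hC₂, h₂⟩ := hNC
  set a := (d : ℝ) / p
  have h2a : (0 : ℝ) < 2 ^ a := by positivity
  -- The extra constants pay for passing from `φ(0, 2r)` to `φ(x, 2r)` by nearness (`‖x‖ < r + R ≤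
  -- 2r`), then to `φ(x, r)` by almost decrease, and for `(2r)^a = 2^a r^a`.
  obtain ⟨ρ₀, hρ₀⟩ := eventually_atTop.1 (hlim2.eventually_ge_atTop (N * 2 ^ a * C₁ * C₂))
  refine ⟨max 1 (max ρ₀ R), by positivity, fun x r hr hx => ?_⟩
  have hr1 : 1 ≤ r := (le_max_left _ _).trans hr
  have hr0 : ρ₀ ≤ r := ((le_max_left _ _).trans (le_max_right _ _)).trans hr
  have hrR : R ≤ r := ((le_max_right _ _).trans (le_max_right _ _)).trans hr
  have hpos := hφ.pos 0 (2 * r) (by linarith)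
  have e1 := hρ₀ (2 * r) (by linarith)
  have e2 := (h₂ x 0 (2 * r) (by linarith) (by rw [dist_zero_right]; linarith)).1
  have e3 := (h₁ x r (2 * r) (by linarith) (by linarith)).2
  rw [le_div_iff₀ hpos, div_mul_eq_mul_div, one_mul, div_le_iff₀ hC₂] at e2
  rw [Real.mul_rpow (by norm_num) (by linarith)] at e1
  have hra : 0 < r ^ a := by positivity
  have e4 : φ 0 (2 * r) ≤ C₁ * φ x r * C₂ := e2.trans (by gcongr)
  have e5 : N * 2 ^ a * C₁ * C₂ ≤ 2 ^ a * r ^ a * (C₁ * φ x r * C₂) := e1.trans (by gcongr)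
  have e6 : N * (2 ^ a * C₁ * C₂) ≤ (r ^ a * φ x r) * (2 ^ a * C₁ * C₂) := by
    calc _ = N * 2 ^ a * C₁ * C₂ := by ring
      _ ≤ _ := e5
      _ = _ := by ring
  exact le_of_mul_le_mul_right e6 (by positivity)

/-- Lower bound of `r^{d/p} φ` on balls of radius bounded below that meet a bounded set. -/
theorem GDec.exists_pos_le (hφ : GDec p φ) (hp : 0 < p) (hNC : Nearness φ)
    (hlim2 : LargeScaleLim p φ) (R : ℝ) {δ : ℝ} (hδ : 0 < δ) :
    ∃ c : ℝ, 0 < c ∧ ∀ (x : Eucl d) (r : ℝ), δ ≤ r → ‖x‖ < r + R →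
      c ≤ r ^ ((d : ℝ) / p) * φ x r := by
  obtain ⟨C₁, hC₁, h₁⟩ := hφ.almost_mono
  obtain ⟨ρ, hρ0, hρ⟩ := hlim2.exists_le hφ hNC R 1
  set a := (d : ℝ) / p
  have ha : 0 ≤ a := by positivity
  have hρa : 0 < ρ ^ a := by positivity
  have hδa : 0 < δ ^ a := by positivity
  -- Radii beyond `ρ` give the bound `1`. For `δ ≤ r < ρ`, almost decrease compares `φ(x, r)` with
  -- `φ(x, ρ) ≥ ρ^(-a)`.
  refine ⟨min 1 (δ ^ a / (ρ ^ a * C₁)), by positivity, fun x r hr hx => ?_⟩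
  rcases le_or_gt ρ r with h | h
  · exact (min_le_left _ _).trans (hρ x r h hx)
  · refine (min_le_right _ _).trans ?_
    have hr0 : 0 < r := hδ.trans_le hr
    have e1 := hρ x ρ le_rfl (by linarith)
    have e2 := (h₁ x r ρ hr0 h).2
    have hφr := hφ.pos x r hr0
    rw [div_le_iff₀ (by positivity)]
    have e3 : δ ^ a ≤ r ^ a := Real.rpow_le_rpow hδ.le hr ha
    have e4 : 1 ≤ ρ ^ a * (C₁ * φ x r) := e1.trans (by gcongr)
    calc δ ^ a ≤ r ^ a * 1 := by rwa [mul_one]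
      _ ≤ r ^ a * (ρ ^ a * (C₁ * φ x r)) := by gcongr
      _ = _ := by ring

end growth

/-! ### Estimates of means over balls. -/

section means

variable {d : ℕ} {𝕜 : Type*} [RCLike 𝕜] {p : ℝ} {φ : Eucl d → ℝ → ℝ}

theorem volume_unitBall_rpow_pos :
    0 < volume (Metric.ball (0 : Eucl d) 1) ^ (1 / p) :=
  ENNReal.rpow_pos (Metric.measure_ball_pos _ _ one_pos) measure_ball_lt_top.ne

theorem volume_unitBall_rpow_ne_top (hp : 0 < p) :
    volume (Metric.ball (0 : Eucl d) 1) ^ (1 / p) ≠ ⊤ :=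
  ENNReal.rpow_ne_top_of_nonneg (by positivity) measure_ball_lt_top.ne

theorem meanP_eq_eLpNorm_div (hp : 0 < p) (f : Eucl d → 𝕜) (x : Eucl d) {r : ℝ} (hr : 0 < r) :
    meanP p f x r = eLpNorm f (ENNReal.ofReal p) (volume.restrict (Metric.ball x r)) /
      (volume (Metric.ball (0 : Eucl d) 1) ^ (1 / p) * ENNReal.ofReal (r ^ ((d : ℝ) / p))) := by
  rw [meanP, setLAverage_eq, ENNReal.div_rpow_of_nonneg _ _ (by positivity),
    eLpNorm_eq_lintegral_rpow_enorm_toReal (by simpa using hp) ENNReal.ofReal_ne_top,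
    ENNReal.toReal_ofReal hp.le, Measure.addHaar_ball_of_pos _ _ hr,
    ENNReal.mul_rpow_of_nonneg _ _ (by positivity),
    ENNReal.ofReal_rpow_of_nonneg (by positivity) (by positivity), finrank_euclideanSpace_fin,
    ← Real.rpow_natCast, ← Real.rpow_mul hr.le, mul_comm (ENNReal.ofReal _), mul_one_div]

theorem meanP_div_eq (hp : 0 < p) (hφ : GDec p φ) (f : Eucl d → 𝕜) (x : Eucl d) {r : ℝ}
    (hr : 0 < r) :
    meanP p f x r / ENNReal.ofReal (φ x r) =
      eLpNorm f (ENNReal.ofReal p) (volume.restrict (Metric.ball x r)) /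
      (volume (Metric.ball (0 : Eucl d) 1) ^ (1 / p) *
        ENNReal.ofReal (r ^ ((d : ℝ) / p) * φ x r)) := by
  have h1 : 0 < r ^ ((d : ℝ) / p) := by positivity
  have h2 := hφ.pos x r hr
  rw [meanP_eq_eLpNorm_div hp f x hr, ENNReal.ofReal_mul h1.le, ← mul_assoc]
  simp only [div_eq_mul_inv]
  rw [ENNReal.mul_inv (b := ENNReal.ofReal (φ x r)) (Or.inr ENNReal.ofReal_ne_top)
    (Or.inr (by simpa using h2)), mul_assoc]

theorem meanP_le_of_ae_le (hp : 0 < p) {f : Eucl d → 𝕜} {K : ℝ≥0∞} (hK : ∀ᵐ y, ‖f y‖ₑ ≤ K)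
    (x : Eucl d) {r : ℝ} (hr : 0 < r) : meanP p f x r ≤ K := by
  have hv : volume (Metric.ball x r) ≠ 0 := (Metric.measure_ball_pos _ _ hr).ne'
  have h1 : ⨍⁻ y in Metric.ball x r, ‖f y‖ₑ ^ p ∂volume ≤ K ^ p := by
    rw [setLAverage_eq]
    refine ENNReal.div_le_of_le_mul ?_
    rw [← setLIntegral_const]
    refine lintegral_mono_ae (ae_restrict_of_ae ?_)
    filter_upwards [hK] with y hy
    exact ENNReal.rpow_le_rpow hy hp.le
  calc meanP p f x r ≤ (K ^ p) ^ (1 / p) := ENNReal.rpow_le_rpow h1 (by positivity)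
    _ = K := by rw [← ENNReal.rpow_mul, mul_one_div_cancel hp.ne', ENNReal.rpow_one]

theorem meanP_eq_zero_of_disjoint (hp : 0 < p) {f : Eucl d → 𝕜} {R : ℝ}
    (hf : ∀ᵐ y, y ∉ Metric.ball (0 : Eucl d) R → f y = 0) {x : Eucl d} {r : ℝ}
    (hx : r + R ≤ ‖x‖) : meanP p f x r = 0 := by
  have h1 : ∫⁻ y in Metric.ball x r, ‖f y‖ₑ ^ p ∂volume = 0 := by
    rw [← lintegral_zero (μ := volume.restrict (Metric.ball x r))]
    refine lintegral_congr_ae ?_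
    filter_upwards [ae_restrict_mem Metric.isOpen_ball.measurableSet, ae_restrict_of_ae hf]
      with y hy h
    rw [h, enorm_zero, ENNReal.zero_rpow_of_pos hp]
    intro h2
    rw [mem_ball_zero_iff] at h2
    rw [Metric.mem_ball, dist_eq_norm] at hy
    have := norm_sub_norm_le x y
    rw [norm_sub_rev] at this
    linarith
  rw [meanP, setLAverage_eq, h1, ENNReal.zero_div, ENNReal.zero_rpow_of_pos (by positivity)]

/-- Bounded functions supported in a fixed ball: the Morrey norm is controlled by a small multiple
of the supremum and a multiple of the `L^p` norm. -/
theorem exists_morreyENorm_le (hp : 0 < p) (hφ : GDec p φ) (hNC : Nearness φ)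
    (hlim1 : SmallScaleLim φ) (hlim2 : LargeScaleLim p φ) (R : ℝ) {ε : ℝ} (hε : 0 < ε) :
    ∃ C : ℝ≥0∞, C ≠ ⊤ ∧ ∀ (f : Eucl d → 𝕜) (K : ℝ≥0∞), (∀ᵐ y, ‖f y‖ₑ ≤ K) →
      (∀ᵐ y, y ∉ Metric.ball (0 : Eucl d) R → f y = 0) →
      morreyENorm p φ f ≤ ENNReal.ofReal ε * K + C * eLpNorm f (ENNReal.ofReal p) volume := by
  obtain ⟨δ, hδ, h1⟩ := hlim1.exists_le hφ R (1 / ε)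
  obtain ⟨c, hc, h2⟩ := hφ.exists_pos_le hp hNC hlim2 R hδ
  have hω := volume_unitBall_rpow_pos (d := d) (p := p)
  refine ⟨(volume (Metric.ball (0 : Eucl d) 1) ^ (1 / p) * ENNReal.ofReal c)⁻¹, ?_, ?_⟩
  · exact ENNReal.inv_ne_top.2 (mul_ne_zero hω.ne' (by simpa using hc))
  intro f K hK hf
  refine iSup_le fun x => iSup_le fun r => iSup_le fun hr => ?_
  -- Balls missing the support contribute nothing. For `r < δ` the mean is at most `K` and `φ ≥
  -- 1/ε`; for `r ≥ δ` the weight is bounded below and the global `L^p` norm suffices.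
  rcases le_or_gt (r + R) ‖x‖ with hx | hx
  · rw [meanP_eq_zero_of_disjoint hp hf hx, ENNReal.zero_div]
    exact zero_le
  rcases lt_or_ge r δ with h | h
  · refine le_trans ?_ le_self_add
    have h3 := h1 x r hr h hx
    calc meanP p f x r / ENNReal.ofReal (φ x r) ≤ K / ENNReal.ofReal (1 / ε) :=
          ENNReal.div_le_div (meanP_le_of_ae_le hp hK x hr) (ENNReal.ofReal_le_ofReal h3)
      _ = ENNReal.ofReal ε * K := by
          rw [one_div, ENNReal.ofReal_inv_of_pos hε, div_eq_mul_inv, inv_inv, mul_comm]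
  · refine le_trans ?_ le_add_self
    rw [meanP_div_eq hp hφ f x hr, mul_comm _ (eLpNorm _ _ _), ← div_eq_mul_inv]
    refine ENNReal.div_le_div (eLpNorm_mono_measure _ Measure.restrict_le_self) ?_
    gcongr
    exact h2 x r h hx

theorem morreyENorm_lt_top_of_bounded (hp : 0 < p) (hφ : GDec p φ) (hNC : Nearness φ)
    (hlim1 : SmallScaleLim φ) (hlim2 : LargeScaleLim p φ) {f : Eucl d → 𝕜} {R K : ℝ}
    (hfm : AEStronglyMeasurable f) (hK : ∀ᵐ y, ‖f y‖ ≤ K)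
    (hf : ∀ᵐ y, y ∉ Metric.ball (0 : Eucl d) R → f y = 0) : morreyENorm p φ f < ⊤ := by
  obtain ⟨C, hC, h⟩ := exists_morreyENorm_le (𝕜 := 𝕜) hp hφ hNC hlim1 hlim2 R one_pos
  have hK' : ∀ᵐ y, ‖f y‖ₑ ≤ ENNReal.ofReal K := by
    filter_upwards [hK] with y hy
    rw [← ofReal_norm]; exact ENNReal.ofReal_le_ofReal hy
  refine (h f _ hK' hf).trans_lt (ENNReal.add_lt_top.2 ⟨?_, ENNReal.mul_lt_top hC.lt_top ?_⟩)
  · exact ENNReal.mul_lt_top ENNReal.ofReal_lt_top ENNReal.ofReal_lt_top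
  · have h1 : MemLp ((Metric.ball (0 : Eucl d) R).indicator fun _ => K) (ENNReal.ofReal p)
        volume := memLp_indicator_const _ Metric.isOpen_ball.measurableSet _
          (Or.inr measure_ball_lt_top.ne)
    refine (h1.mono hfm ?_).2
    filter_upwards [hK, hf] with y h2 h3
    by_cases hy : y ∈ Metric.ball (0 : Eucl d) R
    · rw [Set.indicator_of_mem hy]; exact h2.trans (le_abs_self _)
    · rw [h3 hy, norm_zero]; positivity

end means

/-! ### The normalization linking `L^p` norms on balls to Morrey quotients. -/

section weight

variable {d : ℕ} {𝕜 : Type*} [RCLike 𝕜] {p : ℝ} {φ : Eucl d → ℝ → ℝ}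

/-- The factor `|B(0,1)|^{1/p} r^{d/p} φ(x,r)` relating `‖f‖_{L^p(B)}` and `M_p(f,B) / φ(B)`. -/
noncomputable def ballWeight {d : ℕ} (p : ℝ) (φ : Eucl d → ℝ → ℝ) (x : Eucl d) (r : ℝ) : ℝ≥0∞ :=
  volume (Metric.ball (0 : Eucl d) 1) ^ (1 / p) * ENNReal.ofReal (r ^ ((d : ℝ) / p) * φ x r)

theorem ballWeight_ne_zero (hφ : GDec p φ) (x : Eucl d) {r : ℝ} (hr : 0 < r) :
    ballWeight p φ x r ≠ 0 := by
  have := hφ.pos x r hr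
  exact mul_ne_zero volume_unitBall_rpow_pos.ne' (by simp; positivity)

theorem ballWeight_ne_top (hp : 0 < p) (x : Eucl d) (r : ℝ) : ballWeight p φ x r ≠ ⊤ :=
  ENNReal.mul_ne_top (volume_unitBall_rpow_ne_top hp) ENNReal.ofReal_ne_top

theorem eLpNorm_ball_eq (hp : 0 < p) (hφ : GDec p φ) (f : Eucl d → 𝕜) (x : Eucl d) {r : ℝ}
    (hr : 0 < r) : eLpNorm ((Metric.ball x r).indicator f) (ENNReal.ofReal p) volume =
      meanP p f x r / ENNReal.ofReal (φ x r) * ballWeight p φ x r := by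
  rw [meanP_div_eq hp hφ f x hr, eLpNorm_indicator_eq_eLpNorm_restrict
    Metric.isOpen_ball.measurableSet, ← ballWeight,
    ENNReal.div_mul_cancel (ballWeight_ne_zero hφ x hr) (ballWeight_ne_top hp x r)]

theorem eLpNorm_ball_le (hp : 0 < p) (hφ : GDec p φ) (f : Eucl d → 𝕜) (x : Eucl d) {r : ℝ}
    (hr : 0 < r) : eLpNorm ((Metric.ball x r).indicator f) (ENNReal.ofReal p) volume ≤
      morreyENorm p φ f * ballWeight p φ x r := by
  rw [eLpNorm_ball_eq hp hφ f x hr]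
  gcongr
  exact meanP_div_le_morreyENorm f x hr

theorem morreyENorm_mono (hp : 0 < p) {f g : Eucl d → 𝕜} (h : ∀ᵐ y, ‖f y‖ ≤ ‖g y‖) :
    morreyENorm p φ f ≤ morreyENorm p φ g := by
  refine iSup_le fun x => iSup_le fun r => iSup_le fun hr => ?_
  refine le_trans (ENNReal.div_le_div_right ?_ _) (meanP_div_le_morreyENorm g x hr)
  rw [meanP_eq_eLpNorm', meanP_eq_eLpNorm']
  exact eLpNorm'_mono_ae hp.le (ae_ball_of_ae h x r)

end weight

/-! ### Restriction operators from the Morrey space to `L^p`. -/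

namespace MorreySpace

variable {d : ℕ} {𝕜 : Type*} [RCLike 𝕜] {p : ℝ} [hp : Fact (1 ≤ p)] {φ : Eucl d → ℝ → ℝ}

/-- The element of the Morrey space given by a function. -/
noncomputable def ofFun (f : Eucl d → 𝕜) (hf : AEStronglyMeasurable f volume)
    (h : morreyENorm p φ f < ⊤) : MorreySpace 𝕜 p φ :=
  ⟨AEEqFun.mk f hf, by
    change morreyENorm p φ (AEEqFun.mk f hf : Eucl d → 𝕜) < ⊤
    rwa [morreyENorm_congr (AEEqFun.coeFn_mk f hf)]⟩

theorem coeFn_ofFun (f : Eucl d → 𝕜) (hf : AEStronglyMeasurable f volume)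
    (h : morreyENorm p φ f < ⊤) : (ofFun f hf h : Eucl d → 𝕜) =ᵐ[volume] f :=
  AEEqFun.coeFn_mk f hf

theorem aestronglyMeasurable (g : MorreySpace 𝕜 p φ) : AEStronglyMeasurable g volume :=
  AEEqFun.aestronglyMeasurable g.toAEEqFun

theorem coeFn_sub (f g : MorreySpace 𝕜 p φ) :
    ((f - g : MorreySpace 𝕜 p φ) : Eucl d → 𝕜) =ᵐ[volume] (f : Eucl d → 𝕜) - (g : Eucl d → 𝕜) :=
  AEEqFun.coeFn_sub f.toAEEqFun g.toAEEqFun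

theorem ofReal_norm_eq (g : MorreySpace 𝕜 p φ) : ENNReal.ofReal ‖g‖ = morreyENorm p φ g := by
  rw [norm_def, ENNReal.ofReal_toReal g.morreyENorm_lt_top.ne]

theorem norm_le_of_morreyENorm_le (g : MorreySpace 𝕜 p φ) {a : ℝ} (ha : 0 ≤ a)
    (h : morreyENorm p φ g ≤ ENNReal.ofReal a) : ‖g‖ ≤ a := by
  rw [norm_def]
  exact ENNReal.toReal_le_of_le_ofReal ha h

theorem memLp_indicator_ball (hφ : GDec p φ) (g : MorreySpace 𝕜 p φ) (x : Eucl d) {r : ℝ}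
    (hr : 0 < r) : MemLp ((Metric.ball x r).indicator g) (ENNReal.ofReal p) volume := by
  have hp0 : 0 < p := one_pos.trans_le hp.out
  exact ⟨g.aestronglyMeasurable.indicator Metric.isOpen_ball.measurableSet,
    (eLpNorm_ball_le hp0 hφ g x hr).trans_lt
      (ENNReal.mul_lt_top g.morreyENorm_lt_top (ballWeight_ne_top hp0 x r).lt_top)⟩

variable [Fact (1 ≤ ENNReal.ofReal p)]

/-- Restriction to a ball, as an operator from the Morrey space to `L^p`. -/
noncomputable def toLpBall (hφ : GDec p φ) (x : Eucl d) {r : ℝ} (hr : 0 < r) :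
    MorreySpace 𝕜 p φ →L[𝕜] Lp 𝕜 (ENNReal.ofReal p) (volume : Measure (Eucl d)) :=
  LinearMap.mkContinuous
    { toFun := fun g => (g.memLp_indicator_ball hφ x hr).toLp _
      map_add' := fun f g => by
        rw [← MemLp.toLp_add]
        refine MemLp.toLp_congr _ _ ?_
        filter_upwards [coeFn_add f g] with y hy
        by_cases h : y ∈ Metric.ball x r <;> simp [h, hy]
      map_smul' := fun c g => by
        rw [RingHom.id_apply, ← MemLp.toLp_const_smul]
        refine MemLp.toLp_congr _ _ ?_
        filter_upwards [coeFn_smul c g] with y hy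
        by_cases h : y ∈ Metric.ball x r <;> simp [h, hy] }
    (ballWeight p φ x r).toReal (fun g => by
      have hp0 : 0 < p := one_pos.trans_le hp.out
      change ‖(g.memLp_indicator_ball hφ x hr).toLp _‖ ≤ _
      rw [Lp.norm_toLp, norm_def, ← ENNReal.toReal_mul, mul_comm]
      exact ENNReal.toReal_mono (ENNReal.mul_ne_top g.morreyENorm_lt_top.ne
        (ballWeight_ne_top hp0 x r)) (eLpNorm_ball_le hp0 hφ g x hr))

theorem toLpBall_apply (hφ : GDec p φ) (x : Eucl d) {r : ℝ} (hr : 0 < r)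
    (g : MorreySpace 𝕜 p φ) : toLpBall hφ x hr g = (g.memLp_indicator_ball hφ x hr).toLp _ := rfl

theorem coeFn_toLpBall (hφ : GDec p φ) (x : Eucl d) {r : ℝ} (hr : 0 < r)
    (g : MorreySpace 𝕜 p φ) : toLpBall hφ x hr g =ᵐ[volume] (Metric.ball x r).indicator g :=
  MemLp.coeFn_toLp (g.memLp_indicator_ball hφ x hr)

theorem norm_toLpBall_le (hφ : GDec p φ) (x : Eucl d) {r : ℝ} (hr : 0 < r)
    (g : MorreySpace 𝕜 p φ) : ‖toLpBall hφ x hr g‖ ≤ (ballWeight p φ x r).toReal * ‖g‖ :=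
  LinearMap.mkContinuous_norm_le _ ENNReal.toReal_nonneg _ |> fun h =>
    (ContinuousLinearMap.le_opNorm _ _).trans (mul_le_mul_of_nonneg_right h (norm_nonneg _))

theorem enorm_toLpBall (hφ : GDec p φ) (x : Eucl d) {r : ℝ} (hr : 0 < r)
    (g : MorreySpace 𝕜 p φ) : ‖toLpBall hφ x hr g‖ₑ =
      meanP p g x r / ENNReal.ofReal (φ x r) * ballWeight p φ x r := by
  rw [toLpBall_apply, Lp.enorm_toLp, eLpNorm_ball_eq (one_pos.trans_le hp.out) hφ _ x hr]

end MorreySpace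

/-! ### Approximation by test functions. -/

section density

variable {d : ℕ} {𝕜 : Type*} [RCLike 𝕜] {p : ℝ} {φ : Eucl d → ℝ → ℝ}

open scoped Convolution in
theorem norm_convolution_le_of_bound (ρ : ContDiffBump (0 : Eucl d)) {f : Eucl d → 𝕜} {K : ℝ}
    (hK : ∀ x, ‖f x‖ ≤ K) (x : Eucl d) :
    ‖(ρ.normed volume ⋆[ContinuousLinearMap.lsmul ℝ ℝ, volume] f) x‖ ≤ K := by
  rw [convolution_def]
  calc ‖∫ t, ContinuousLinearMap.lsmul ℝ ℝ (ρ.normed volume t) (f (x - t))‖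
      ≤ ∫ t, ρ.normed volume t * K := by
        refine norm_integral_le_of_norm_le (ρ.integrable_normed.mul_const K)
          (Eventually.of_forall fun t => ?_)
        rw [ContinuousLinearMap.lsmul_apply, norm_smul, Real.norm_of_nonneg (ρ.nonneg_normed t)]
        exact mul_le_mul_of_nonneg_left (hK _) (ρ.nonneg_normed t)
    _ = K := by rw [integral_mul_const, ρ.integral_normed, one_mul]

open scoped Convolution in
/-- Bounded functions of bounded support are approximated by test functions in the Morrey norm. -/
theorem exists_test_approx (hp : 0 < p) (hφ : GDec p φ) (hNC : Nearness φ)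
    (hlim1 : SmallScaleLim φ) (hlim2 : LargeScaleLim p φ) {f : Eucl d → 𝕜} {R K : ℝ}
    (hfm : AEStronglyMeasurable f volume) (hK : ∀ y, ‖f y‖ ≤ K)
    (hf : ∀ y, y ∉ Metric.ball (0 : Eucl d) R → f y = 0) {η : ℝ} (hη : 0 < η) :
    ∃ h : Eucl d → 𝕜, ContDiff ℝ ∞ h ∧ HasCompactSupport h ∧
      morreyENorm p φ (h - f) < ENNReal.ofReal η := by
  have hP0 : ENNReal.ofReal p ≠ 0 := by simpa using hp
  have hK0 : 0 ≤ K := (norm_nonneg _).trans (hK 0)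
  have hball : MeasurableSet (Metric.ball (0 : Eucl d) (R + 1)) :=
    Metric.isOpen_ball.measurableSet
  let ρ : ℕ → ContDiffBump (0 : Eucl d) := fun n =>
    ⟨1 / ((n : ℝ) + 1) / 2, 1 / ((n : ℝ) + 1), by positivity, half_lt_self (by positivity)⟩
  have hρ : ∀ n, (ρ n).rOut = 1 / ((n : ℝ) + 1) := fun n => rfl
  have hρ1 : ∀ n, (ρ n).rOut ≤ 1 := fun n => by
    rw [hρ, div_le_one (by positivity)]; linarith [(Nat.cast_nonneg n : (0 : ℝ) ≤ n)]
  set h : ℕ → Eucl d → 𝕜 := fun n =>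
    (ρ n).normed volume ⋆[ContinuousLinearMap.lsmul ℝ ℝ, volume] f with hh
  have hfint : Integrable f volume := by
    have h1 : IntegrableOn (fun _ : Eucl d => K) (Metric.ball 0 R) volume :=
      integrableOn_const measure_ball_lt_top.ne
    rw [← integrable_indicator_iff Metric.isOpen_ball.measurableSet] at h1
    refine h1.mono hfm (Eventually.of_forall fun y => ?_)
    by_cases hy : y ∈ Metric.ball (0 : Eucl d) R
    · rw [Set.indicator_of_mem hy]; exact (hK y).trans (le_abs_self _)
    · rw [hf y hy, norm_zero]; positivity
  have hfc : HasCompactSupport f :=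
    HasCompactSupport.of_support_subset_isCompact (isCompact_closedBall (0 : Eucl d) R)
      fun y hy => Metric.ball_subset_closedBall (by by_contra h; exact hy (hf y h))
  have hsmooth : ∀ n, ContDiff ℝ ∞ (h n) := fun n =>
    HasCompactSupport.contDiff_convolution_left _ (ρ n).hasCompactSupport_normed
      (ρ n).contDiff_normed hfint.locallyIntegrable
  have hcomp : ∀ n, HasCompactSupport (h n) := fun n =>
    HasCompactSupport.convolution _ (ρ n).hasCompactSupport_normed hfc
  have hsupp : ∀ n y, y ∉ Metric.ball (0 : Eucl d) (R + 1) → h n y = 0 := by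
    intro n y hy
    by_contra hne
    obtain ⟨a, ha, b, hb, rfl⟩ := support_convolution_subset _ hne
    rw [(ρ n).support_normed_eq, mem_ball_zero_iff] at ha
    have hb' : b ∈ Metric.ball (0 : Eucl d) R := by by_contra h; exact hb (hf b h)
    rw [mem_ball_zero_iff] at hb' hy
    exact hy ((norm_add_le a b).trans_lt (by linarith [hρ1 n]))
  have hbound : ∀ n y, ‖h n y‖ ≤ K := fun n y => norm_convolution_le_of_bound (ρ n) hK y
  have hfsupp : ∀ y, y ∉ Metric.ball (0 : Eucl d) (R + 1) → f y = 0 := fun y hy =>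
    hf y fun h => hy (Metric.ball_subset_ball (by linarith) h)
  have hlim : Tendsto (fun n => eLpNorm (h n - f) (ENNReal.ofReal p) volume) atTop (𝓝 0) := by
    refine tendsto_eLpNorm_sub_of_dominated (g := (Metric.ball (0 : Eucl d) (R + 1)).indicator
      fun _ => K) hP0 ENNReal.ofReal_ne_top
      (fun n => (hsmooth n).continuous.aestronglyMeasurable) hfm
      (memLp_indicator_const _ hball _ (Or.inr measure_ball_lt_top.ne)) (fun n => ?_) ?_ ?_
    · refine Eventually.of_forall fun y => ?_
      by_cases hy : y ∈ Metric.ball (0 : Eucl d) (R + 1)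
      · rw [Set.indicator_of_mem hy]; exact hbound n y
      · rw [Set.indicator_of_notMem hy, hsupp n y hy, norm_zero]
    · refine Eventually.of_forall fun y => ?_
      by_cases hy : y ∈ Metric.ball (0 : Eucl d) (R + 1)
      · rw [Set.indicator_of_mem hy]; exact hK y
      · rw [Set.indicator_of_notMem hy, hfsupp y hy, norm_zero]
    -- The outer radii of the bumps are twice the inner ones, hence the constant `2`.
    · refine ContDiffBump.ae_convolution_tendsto_right_of_locallyIntegrable (K := 2)
        tendsto_one_div_add_atTop_nhds_zero_nat (Eventually.of_forall fun n => ?_)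
        hfint.locallyIntegrable
      change 1 / ((n : ℝ) + 1) ≤ 2 * (1 / ((n : ℝ) + 1) / 2)
      linarith
  -- The difference `h n - f` is only known to be bounded by `2K`, so the coefficient of the
  -- supremum is chosen to make that term at most `η/2`. The `L^p` term tends to zero with `n`.
  obtain ⟨C, hC, hCb⟩ := exists_morreyENorm_le (𝕜 := 𝕜) hp hφ hNC hlim1 hlim2 (R + 1)
    (ε := η / (4 * K + 4)) (by positivity)
  have hlim' := ENNReal.Tendsto.const_mul (a := C) hlim (Or.inr hC)
  rw [mul_zero] at hlim'
  obtain ⟨n, hn⟩ := ((tendsto_order.1 hlim').2 (ENNReal.ofReal (η / 2))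
    (by simpa using hη)).exists
  refine ⟨h n, hsmooth n, hcomp n, ?_⟩
  refine (hCb (h n - f) (ENNReal.ofReal (2 * K)) (Eventually.of_forall fun y => ?_)
    (Eventually.of_forall fun y hy => ?_)).trans_lt ?_
  · rw [← ofReal_norm]
    refine ENNReal.ofReal_le_ofReal ((norm_sub_le _ _).trans ?_)
    linarith [hbound n y, hK y]
  · rw [Pi.sub_apply, hsupp n y hy, hfsupp y hy, sub_zero]
  · have h1 : ENNReal.ofReal (η / (4 * K + 4)) * ENNReal.ofReal (2 * K) ≤
        ENNReal.ofReal (η / 2) := by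
      rw [← ENNReal.ofReal_mul (by positivity)]
      refine ENNReal.ofReal_le_ofReal ?_
      rw [div_mul_eq_mul_div, div_le_div_iff₀ (by positivity) (by norm_num)]
      nlinarith
    calc _ < ENNReal.ofReal (η / 2) + ENNReal.ofReal (η / 2) :=
          ENNReal.add_lt_add_of_le_of_lt (ne_top_of_le_ne_top ENNReal.ofReal_ne_top h1) h1 hn
      _ = ENNReal.ofReal η := by
          rw [← ENNReal.ofReal_add (by positivity) (by positivity), add_halves]

theorem morreyENorm_lt_top_of_contDiff (hp : 0 < p) (hφ : GDec p φ) (hNC : Nearness φ)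
    (hlim1 : SmallScaleLim φ) (hlim2 : LargeScaleLim p φ) {h : Eucl d → 𝕜} (hc : Continuous h)
    (hs : HasCompactSupport h) : morreyENorm p φ h < ⊤ := by
  obtain ⟨K, hK⟩ := hs.exists_bound_of_continuous hc
  obtain ⟨R, hR⟩ := hs.isBounded.subset_ball (0 : Eucl d)
  exact morreyENorm_lt_top_of_bounded hp hφ hNC hlim1 hlim2 (R := R) hc.aestronglyMeasurable
    (Eventually.of_forall hK) (Eventually.of_forall fun y hy =>
      image_eq_zero_of_notMem_tsupport fun h => hy (hR h))

/-- Bounded functions of bounded support belong to the closure of the test functions. -/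
theorem mem_morreyClosure_of_bounded [Fact (1 ≤ p)] (hφ : GDec p φ) (hNC : Nearness φ)
    (hlim1 : SmallScaleLim φ) (hlim2 : LargeScaleLim p φ) {f : Eucl d → 𝕜} {R K : ℝ}
    (hfm : AEStronglyMeasurable f volume) (hK : ∀ y, ‖f y‖ ≤ K)
    (hf : ∀ y, y ∉ Metric.ball (0 : Eucl d) R → f y = 0) (hfin : morreyENorm p φ f < ⊤) :
    MorreySpace.ofFun f hfm hfin ∈ morreyClosure 𝕜 p φ := by
  have hp0 : 0 < p := one_pos.trans_le Fact.out
  change _ ∈ closure (morreyTestFunctions 𝕜 p φ : Set (MorreySpace 𝕜 p φ))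
  rw [Metric.mem_closure_iff]
  intro η hη
  obtain ⟨h, hsm, hcs, hlt⟩ := exists_test_approx hp0 hφ hNC hlim1 hlim2 hfm hK hf hη
  have hh := morreyENorm_lt_top_of_contDiff hp0 hφ hNC hlim1 hlim2 hsm.continuous hcs
  refine ⟨MorreySpace.ofFun h hsm.continuous.aestronglyMeasurable hh,
    ⟨h, hsm, hcs, MorreySpace.coeFn_ofFun _ _ _⟩, ?_⟩
  rw [dist_comm, dist_eq_norm, MorreySpace.norm_def]
  refine (ENNReal.toReal_lt_of_lt_ofReal ?_)
  refine lt_of_eq_of_lt (morreyENorm_congr ?_) hlt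
  exact (MorreySpace.coeFn_sub _ _).trans
    ((MorreySpace.coeFn_ofFun _ _ _).sub (MorreySpace.coeFn_ofFun _ _ _))

end density

/-! ### The bilinear pairing of `L^q` with `L^p`. -/

section pairing

variable {α : Type*} {m : MeasurableSpace α} {μ : Measure α} {𝕜 : Type*} [RCLike 𝕜]

/-- Restriction of an `L^p` function to a measurable set. -/
noncomputable def lpIndicator {p : ℝ≥0∞} {s : Set α} (hs : MeasurableSet s) (u : Lp 𝕜 p μ) :
    Lp 𝕜 p μ := ((Lp.memLp u).indicator hs).toLp _

theorem coeFn_lpIndicator {p : ℝ≥0∞} {s : Set α} (hs : MeasurableSet s) (u : Lp 𝕜 p μ) :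
    lpIndicator hs u =ᵐ[μ] s.indicator u := by
  unfold lpIndicator
  exact ((Lp.memLp u).indicator hs).coeFn_toLp

variable {p q : ℝ≥0∞} [Fact (1 ≤ p)] [Fact (1 ≤ q)] [ENNReal.HolderConjugate q p]

theorem lpPairing_mul_apply (u : Lp 𝕜 q μ) (h : Lp 𝕜 p μ) :
    (ContinuousLinearMap.mul 𝕜 𝕜).lpPairing μ q p u h = ∫ x, u x * h x ∂μ :=
  ContinuousLinearMap.lpPairing_eq_integral _ _ _

/-- Hölder's inequality with constant exactly `1`, which is what yields `‖g‖ ≤ ‖Λ‖` without loss for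
represented functionals. -/
theorem norm_lpPairing_mul_le (u : Lp 𝕜 q μ) (h : Lp 𝕜 p μ) :
    ‖(ContinuousLinearMap.mul 𝕜 𝕜).lpPairing μ q p u h‖ ≤ ‖u‖ * ‖h‖ := by
  have h1 : (ContinuousLinearMap.mul 𝕜 𝕜).lpPairing μ q p u h =
      L1.integral ((ContinuousLinearMap.mul 𝕜 𝕜).holder 1 u h) := by
    rw [L1.integral_eq_integral, lpPairing_mul_apply]
    exact integral_congr_ae ((ContinuousLinearMap.mul 𝕜 𝕜).coeFn_holder u h).symm
  rw [h1]
  refine (L1.norm_integral_le _).trans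
    ((ContinuousLinearMap.norm_holder_apply_apply_le _ _ _).trans ?_)
  have : ‖ContinuousLinearMap.mul 𝕜 𝕜‖ ≤ 1 := ContinuousLinearMap.opNorm_mul_le 𝕜 𝕜
  nlinarith [mul_nonneg (norm_nonneg u) (norm_nonneg h)]

theorem lpPairing_mul_comm [ENNReal.HolderConjugate p q] (u : Lp 𝕜 q μ) (h : Lp 𝕜 p μ) :
    (ContinuousLinearMap.mul 𝕜 𝕜).lpPairing μ q p u h =
      (ContinuousLinearMap.mul 𝕜 𝕜).lpPairing μ p q h u := by
  rw [lpPairing_mul_apply, lpPairing_mul_apply]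
  simp_rw [mul_comm]

theorem lpPairing_mul_indicator {s : Set α} (hs : MeasurableSet s) (u : Lp 𝕜 q μ)
    (h : Lp 𝕜 p μ) : (ContinuousLinearMap.mul 𝕜 𝕜).lpPairing μ q p (lpIndicator hs u) h =
      (ContinuousLinearMap.mul 𝕜 𝕜).lpPairing μ q p u (lpIndicator hs h) := by
  rw [lpPairing_mul_apply, lpPairing_mul_apply]
  refine integral_congr_ae ?_
  filter_upwards [coeFn_lpIndicator hs u, coeFn_lpIndicator hs h] with x h1 h2
  rw [h1, h2]
  by_cases hx : x ∈ s <;> simp [hx]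

end pairing

/-! ### Representation of bidual functionals by Morrey functions. -/

section duality

variable {d : ℕ} {𝕜 : Type*} [RCLike 𝕜] {p q : ℝ} [hp : Fact (1 ≤ p)]
  [Fact (1 ≤ ENNReal.ofReal p)] [Fact (1 ≤ ENNReal.ofReal q)]
  [ENNReal.HolderConjugate (ENNReal.ofReal q) (ENNReal.ofReal p)] {φ : Eucl d → ℝ → ℝ}

omit hp in
-- The difference of the two functions is normed by some `u ∈ L^q`. This gives the uniqueness needed
-- to glue local representatives.
theorem lpPairing_mul_ext (hpq : p.HolderConjugate q)
    {h₁ h₂ : Lp 𝕜 (ENNReal.ofReal p) (volume : Measure (Eucl d))}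
    (h : ∀ u, (ContinuousLinearMap.mul 𝕜 𝕜).lpPairing volume (ENNReal.ofReal q)
      (ENNReal.ofReal p) u h₁ = (ContinuousLinearMap.mul 𝕜 𝕜).lpPairing volume
      (ENNReal.ofReal q) (ENNReal.ofReal p) u h₂) : h₁ = h₂ := by
  obtain ⟨u, -, hu⟩ := exists_lpPairing_eq_norm hpq (h₁ - h₂)
  rw [map_sub, h, sub_self, eq_comm, RCLike.ofReal_eq_zero, norm_eq_zero, sub_eq_zero] at hu
  exact hu

variable {X : Type*} [NormedAddCommGroup X] [NormedSpace 𝕜 X] (ι : X →ₗᵢ[𝕜] MorreySpace 𝕜 p φ)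

/-- The functional `v ↦ ∫_{B(x,r)} u v` on the closure of the test functions. -/
noncomputable def ballDual (hφ : GDec p φ) (x : Eucl d) {r : ℝ} (hr : 0 < r) :
    Lp 𝕜 (ENNReal.ofReal q) (volume : Measure (Eucl d)) →L[𝕜]
      StrongDual 𝕜 X :=
  ((ContinuousLinearMap.compL 𝕜 _ _ 𝕜).flip ((MorreySpace.toLpBall hφ x hr).comp
    ι.toContinuousLinearMap)).comp
    ((ContinuousLinearMap.mul 𝕜 𝕜).lpPairing volume (ENNReal.ofReal q) (ENNReal.ofReal p))

theorem ballDual_apply (hφ : GDec p φ) (x : Eucl d) {r : ℝ} (hr : 0 < r)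
    (u : Lp 𝕜 (ENNReal.ofReal q) (volume : Measure (Eucl d))) (v : X) :
    ballDual ι hφ x hr u v = (ContinuousLinearMap.mul 𝕜 𝕜).lpPairing volume (ENNReal.ofReal q)
      (ENNReal.ofReal p) u (MorreySpace.toLpBall hφ x hr (ι v)) := rfl

theorem norm_ballDual_le (hφ : GDec p φ) (x : Eucl d) {r : ℝ} (hr : 0 < r)
    (u : Lp 𝕜 (ENNReal.ofReal q) (volume : Measure (Eucl d))) :
    ‖ballDual ι hφ x hr u‖ ≤ ‖u‖ * (ballWeight p φ x r).toReal := by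
  refine ContinuousLinearMap.opNorm_le_bound _ (by positivity) fun v => ?_
  rw [ballDual_apply, mul_assoc]
  refine (norm_lpPairing_mul_le _ _).trans ?_
  gcongr
  exact (MorreySpace.norm_toLpBall_le hφ x hr (ι v)).trans_eq (by rw [ι.norm_map])

/-- Cutting off `u` has the same effect as cutting off `v`, so functionals over a small ball are
among those over any larger ball. Compatibility of local representatives rests on this. -/
theorem ballDual_eq_of_subset (hφ : GDec p φ) {x y : Eucl d} {r s : ℝ} (hr : 0 < r) (hs : 0 < s)
    (hsub : Metric.ball x r ⊆ Metric.ball y s)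
    (u : Lp 𝕜 (ENNReal.ofReal q) (volume : Measure (Eucl d))) :
    ballDual ι hφ x hr u =
      ballDual ι hφ y hs (lpIndicator (s := Metric.ball x r) Metric.isOpen_ball.measurableSet u) := by
  ext v
  rw [ballDual_apply, ballDual_apply, lpPairing_mul_indicator]
  congr 1
  refine Lp.ext ?_
  filter_upwards [MorreySpace.coeFn_toLpBall hφ x hr (ι v),
    MorreySpace.coeFn_toLpBall hφ y hs (ι v),
    coeFn_lpIndicator (s := Metric.ball x r) Metric.isOpen_ball.measurableSet
      (MorreySpace.toLpBall hφ y hs (ι v))] with z h1 h2 h3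
  rw [h1, h3]
  by_cases hz : z ∈ Metric.ball x r
  · rw [Set.indicator_of_mem hz, Set.indicator_of_mem hz, h2, Set.indicator_of_mem (hsub hz)]
  · rw [Set.indicator_of_notMem hz, Set.indicator_of_notMem hz]

/-- A function representing a functional on the dual has Morrey norm bounded by the norm of the
functional. -/
theorem morreyENorm_le_of_represents (hφ : GDec p φ) (hpq : p.HolderConjugate q)
    (Λ : StrongDual 𝕜 (StrongDual 𝕜 X)) (g : Eucl d → 𝕜)
    (h : ∀ (x : Eucl d) (r : ℝ) (hr : 0 < r),
      ∃ G : Lp 𝕜 (ENNReal.ofReal p) (volume : Measure (Eucl d)),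
        G =ᵐ[volume] (Metric.ball x r).indicator g ∧
        ∀ u : Lp 𝕜 (ENNReal.ofReal q) (volume : Measure (Eucl d)), Λ (ballDual ι hφ x hr u) =
          (ContinuousLinearMap.mul 𝕜 𝕜).lpPairing volume (ENNReal.ofReal q) (ENNReal.ofReal p)
            u G) : morreyENorm p φ g ≤ ENNReal.ofReal ‖Λ‖ := by
  refine iSup_le fun x => iSup_le fun r => iSup_le fun hr => ?_
  obtain ⟨G, hG, hΛ⟩ := h x r hr
  have hp0 : 0 < p := hpq.pos
  -- For this `u`, the value `Λ(ballDual u)` is `‖G‖`, while `ballDual u` has norm at most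
  -- `ballWeight`. Dividing by `ballWeight` gives the Morrey quotient.
  obtain ⟨u, hu1, hu⟩ := exists_lpPairing_eq_norm hpq G
  have h1 : ‖G‖ ≤ ‖Λ‖ * (ballWeight p φ x r).toReal := by
    calc ‖G‖ = ‖Λ (ballDual ι hφ x hr u)‖ := by rw [hΛ, hu]; simp
      _ ≤ ‖Λ‖ * ‖ballDual ι hφ x hr u‖ := Λ.le_opNorm _
      _ ≤ ‖Λ‖ * (1 * (ballWeight p φ x r).toReal) := by
        gcongr
        exact (norm_ballDual_le ι hφ x hr u).trans (by gcongr)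
      _ = _ := by rw [one_mul]
  have h2 := ENNReal.ofReal_le_ofReal h1
  rw [ENNReal.ofReal_mul (norm_nonneg Λ), ENNReal.ofReal_toReal (ballWeight_ne_top hp0 x r),
    ofReal_norm, Lp.enorm_def, eLpNorm_congr_ae hG, eLpNorm_ball_eq hp0 hφ g x hr] at h2
  exact (ENNReal.mul_le_mul_iff_left (ballWeight_ne_zero hφ x hr)
    (ballWeight_ne_top hp0 x r)).1 h2

/-- `g` represents `Λ` on the functionals given by `L^q` functions of bounded support. -/
def Represents (q : ℝ) [Fact (1 ≤ ENNReal.ofReal q)]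
    [ENNReal.HolderConjugate (ENNReal.ofReal q) (ENNReal.ofReal p)] (hφ : GDec p φ)
    (Λ : StrongDual 𝕜 (StrongDual 𝕜 X)) (g : MorreySpace 𝕜 p φ) : Prop :=
  ∀ (x : Eucl d) (r : ℝ) (hr : 0 < r)
    (u : Lp 𝕜 (ENNReal.ofReal q) (volume : Measure (Eucl d))), Λ (ballDual ι hφ x hr u) =
    (ContinuousLinearMap.mul 𝕜 𝕜).lpPairing volume (ENNReal.ofReal q) (ENNReal.ofReal p)
      u (MorreySpace.toLpBall hφ x hr g)

theorem Represents.norm_le {ι : X →ₗᵢ[𝕜] MorreySpace 𝕜 p φ} {hφ : GDec p φ} (hpq : p.HolderConjugate q)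
    {Λ : StrongDual 𝕜 (StrongDual 𝕜 X)} {g : MorreySpace 𝕜 p φ}
    (h : Represents ι q hφ Λ g) : ‖g‖ ≤ ‖Λ‖ :=
  g.norm_le_of_morreyENorm_le (norm_nonneg Λ) <|
    morreyENorm_le_of_represents ι hφ hpq Λ g fun x r hr =>
      ⟨_, MorreySpace.coeFn_toLpBall hφ x hr g, h x r hr⟩

theorem Represents.add {ι : X →ₗᵢ[𝕜] MorreySpace 𝕜 p φ} {hφ : GDec p φ}
    {Λ₁ Λ₂ : StrongDual 𝕜 (StrongDual 𝕜 X)} {g₁ g₂ : MorreySpace 𝕜 p φ}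
    (h₁ : Represents ι q hφ Λ₁ g₁) (h₂ : Represents ι q hφ Λ₂ g₂) :
    Represents ι q hφ (Λ₁ + Λ₂) (g₁ + g₂) := fun x r hr u => by
  rw [map_add, map_add, ← h₁ x r hr u, ← h₂ x r hr u]; rfl

theorem Represents.smul {ι : X →ₗᵢ[𝕜] MorreySpace 𝕜 p φ} {hφ : GDec p φ}
    {Λ : StrongDual 𝕜 (StrongDual 𝕜 X)} {g : MorreySpace 𝕜 p φ}
    (h : Represents ι q hφ Λ g) (c : 𝕜) : Represents ι q hφ (c • Λ) (c • g) := fun x r hr u => by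
  rw [map_smul, map_smul, ← h x r hr u]; rfl

theorem represents_inclusionInDoubleDual (hφ : GDec p φ) (v : X) :
    Represents ι q hφ (NormedSpace.inclusionInDoubleDual 𝕜 X v)
      (ι v) := fun _ _ _ _ => rfl

/-- Each functional on the dual is represented by an element of the Morrey space. -/
theorem exists_represents (hφ : GDec p φ) (hpq : p.HolderConjugate q)
    (Λ : StrongDual 𝕜 (StrongDual 𝕜 X)) :
    ∃ g : MorreySpace 𝕜 p φ, Represents ι q hφ Λ g := by
  have hr : ∀ n : ℕ, (0 : ℝ) < (n : ℝ) + 1 := fun n => by positivity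
  have hex : ∀ n : ℕ, ∃ G : Lp 𝕜 (ENNReal.ofReal p) (volume : Measure (Eucl d)),
      ∀ u, Λ (ballDual ι hφ 0 (hr n) u) = (ContinuousLinearMap.mul 𝕜 𝕜).lpPairing volume
        (ENNReal.ofReal q) (ENNReal.ofReal p) u G := by
    intro n
    -- The exponents are swapped: a functional on `L^q` is given by a function in `L^p`.
    obtain ⟨G, -, hG⟩ := exists_lpPairing_eq hpq.symm (Λ.comp (ballDual ι hφ (0 : Eucl d) (hr n)))
    exact ⟨G, fun u => (DFunLike.congr_fun hG u).symm.trans (lpPairing_mul_comm G u)⟩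
  choose G hG using hex
  -- the representative on a ball contained in a large centred ball
  have hloc : ∀ (n : ℕ) (x : Eucl d) (r : ℝ) (hr' : 0 < r),
      Metric.ball x r ⊆ Metric.ball 0 ((n : ℝ) + 1) → ∀ u, Λ (ballDual ι hφ x hr' u) =
        (ContinuousLinearMap.mul 𝕜 𝕜).lpPairing volume (ENNReal.ofReal q) (ENNReal.ofReal p)
          u (lpIndicator (s := Metric.ball x r) Metric.isOpen_ball.measurableSet (G n)) := by
    intro n x r hr' hsub u
    exact (congrArg Λ (ballDual_eq_of_subset ι hφ hr' (hr n) hsub u)).trans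
      ((hG n _).trans (lpPairing_mul_indicator _ u (G n)))
  have hcompat : ∀ᵐ y : Eucl d, ∀ m n : ℕ, m ≤ n →
      G m y = (Metric.ball (0 : Eucl d) ((m : ℝ) + 1)).indicator (G n) y := by
    simp only [ae_all_iff]
    intro m n hmn
    have h1 : G m = lpIndicator (s := Metric.ball (0 : Eucl d) ((m : ℝ) + 1))
        Metric.isOpen_ball.measurableSet (G n) := by
      refine lpPairing_mul_ext hpq fun u => ?_
      exact (hG m u).symm.trans (hloc n 0 _ (hr m) (Metric.ball_subset_ball (by gcongr)) u)
    have h2 := coeFn_lpIndicator (s := Metric.ball (0 : Eucl d) ((m : ℝ) + 1))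
        Metric.isOpen_ball.measurableSet (G n)
    filter_upwards [h2] with y hy
    exact (congrArg (fun u : Lp 𝕜 (ENNReal.ofReal p) volume => u y) h1).trans hy
  -- `⌊‖y‖⌋₊` is the least `n` for which `y` lies in the ball of radius `n + 1`.
  obtain ⟨g, hg⟩ : ∃ g : Eucl d → 𝕜, ∀ y, g y = G ⌊‖y‖⌋₊ y := ⟨_, fun _ => rfl⟩
  have hgm : Measurable g := by
    have h1 : Measurable fun z : ℕ × Eucl d => G z.1 z.2 :=
      measurable_from_prod_countable_right fun n => (Lp.stronglyMeasurable (G n)).measurable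
    rw [funext hg]
    exact h1.comp ((Nat.measurable_floor.comp measurable_norm).prodMk measurable_id)
  have hgG : ∀ᵐ y : Eucl d, ∀ n : ℕ, ‖y‖ < (n : ℝ) + 1 → g y = G n y := by
    filter_upwards [hcompat] with y hy n hn
    have h1 : ⌊‖y‖⌋₊ ≤ n := by
      rw [← Nat.lt_succ_iff, Nat.floor_lt (norm_nonneg _)]
      push_cast; exact hn
    rw [hg, hy _ n h1, Set.indicator_of_mem]
    rw [mem_ball_zero_iff]
    exact Nat.lt_floor_add_one _
  have hrep : ∀ (x : Eucl d) (r : ℝ) (hr' : 0 < r),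
      ∃ H : Lp 𝕜 (ENNReal.ofReal p) (volume : Measure (Eucl d)),
        H =ᵐ[volume] (Metric.ball x r).indicator g ∧
        ∀ u : Lp 𝕜 (ENNReal.ofReal q) (volume : Measure (Eucl d)), Λ (ballDual ι hφ x hr' u) =
          (ContinuousLinearMap.mul 𝕜 𝕜).lpPairing volume (ENNReal.ofReal q) (ENNReal.ofReal p)
            u H := by
    intro x r hr'
    obtain ⟨n, hn⟩ := exists_nat_ge (‖x‖ + r)
    have hsub : Metric.ball x r ⊆ Metric.ball 0 ((n : ℝ) + 1) :=
      Metric.ball_subset_ball' (by rw [dist_zero_right]; linarith)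
    refine ⟨_, ?_, hloc n x r hr' hsub⟩
    filter_upwards [hgG, coeFn_lpIndicator (s := Metric.ball x r)
      Metric.isOpen_ball.measurableSet (G n)] with y h1 h2
    rw [h2]
    by_cases hy : y ∈ Metric.ball x r
    · rw [Set.indicator_of_mem hy, Set.indicator_of_mem hy, h1 n (by simpa using hsub hy)]
    · rw [Set.indicator_of_notMem hy, Set.indicator_of_notMem hy]
  have hfin := (morreyENorm_le_of_represents ι hφ hpq Λ g hrep).trans_lt ENNReal.ofReal_lt_top
  refine ⟨MorreySpace.ofFun g hgm.aestronglyMeasurable hfin, fun x r hr' u => ?_⟩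
  obtain ⟨H, hH, hΛ⟩ := hrep x r hr'
  rw [hΛ]
  congr 1
  refine Lp.ext ?_
  filter_upwards [hH, MorreySpace.coeFn_toLpBall hφ x hr'
    (MorreySpace.ofFun g hgm.aestronglyMeasurable hfin),
    MorreySpace.coeFn_ofFun (φ := φ) g hgm.aestronglyMeasurable hfin] with y h1 h2 h3
  rw [h1, h2]
  by_cases hy : y ∈ Metric.ball x r
  · rw [Set.indicator_of_mem hy, Set.indicator_of_mem hy, h3]
  · rw [Set.indicator_of_notMem hy, Set.indicator_of_notMem hy]

/-- Each element of the Morrey space represents a functional on the dual. -/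
theorem exists_represented (hφ : GDec p φ) (hpq : p.HolderConjugate q) (hNC : Nearness φ)
    (hlim1 : SmallScaleLim φ) (hlim2 : LargeScaleLim p φ)
    (hι : ∀ g, g ∈ morreyClosure 𝕜 p φ ↔ ∃ v, ι v = g) (g : MorreySpace 𝕜 p φ) :
    ∃ Λ : StrongDual 𝕜 (StrongDual 𝕜 X),
      ‖Λ‖ ≤ ‖g‖ ∧ Represents ι q hφ Λ g := by
  have hp0 : 0 < p := hpq.pos
  have hgm : Measurable g := (AEEqFun.stronglyMeasurable g.toAEEqFun).measurable
  -- Truncating both position and height makes `1_{A n} g` bounded with bounded support, hence an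
  -- element of the closure.
  set A : ℕ → Set (Eucl d) := fun n => {y | ‖y‖ < n ∧ ‖g y‖ ≤ n} with hA
  have hAm : ∀ n, MeasurableSet (A n) := fun n =>
    (measurableSet_lt measurable_norm measurable_const).inter
      (measurableSet_le hgm.norm measurable_const)
  have hfm : ∀ n, AEStronglyMeasurable ((A n).indicator g) volume := fun n =>
    (hgm.indicator (hAm n)).aestronglyMeasurable
  have hle : ∀ n, morreyENorm p φ ((A n).indicator g) ≤ morreyENorm p φ g := fun n =>
    morreyENorm_mono hp0 (Eventually.of_forall fun y => norm_indicator_le_norm_self _ _)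
  have hfin : ∀ n, morreyENorm p φ ((A n).indicator g) < ⊤ := fun n =>
    (hle n).trans_lt g.morreyENorm_lt_top
  have hv : ∀ n, ∃ v, ι v = MorreySpace.ofFun _ (hfm n) (hfin n) := fun n =>
    (hι _).1 (mem_morreyClosure_of_bounded (R := n) (K := n) hφ hNC
      hlim1 hlim2 (hfm n) (fun y => by
        by_cases hy : y ∈ A n
        · rw [Set.indicator_of_mem hy]; exact hy.2
        · rw [Set.indicator_of_notMem hy, norm_zero]; positivity)
      (fun y hy => Set.indicator_of_notMem (fun h => hy (by simpa using h.1)) _) (hfin n))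
  choose v hv using hv
  have hvn : ∀ n, ‖v n‖ ≤ ‖g‖ := by
    intro n
    rw [← ι.norm_map, hv]
    refine MorreySpace.norm_le_of_morreyENorm_le _ (norm_nonneg _) ?_
    rw [g.ofReal_norm_eq, morreyENorm_congr (MorreySpace.coeFn_ofFun _ (hfm n) (hfin n))]
    exact hle n
  have hlim : ∀ (x : Eucl d) (r : ℝ) (hr : 0 < r), Tendsto
      (fun n => MorreySpace.toLpBall hφ x hr (ι (v n))) atTop
      (𝓝 (MorreySpace.toLpBall hφ x hr g)) := by
    intro x r hr
    rw [Lp.tendsto_Lp_iff_tendsto_eLpNorm']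
    have hB := MorreySpace.memLp_indicator_ball hφ g x hr
    have hBm : MeasurableSet (Metric.ball x r) := Metric.isOpen_ball.measurableSet
    have h1 := tendsto_eLpNorm_sub_of_dominated (l := atTop) (by simpa using hp0)
      ENNReal.ofReal_ne_top (F := fun n => (Metric.ball x r).indicator ((A n).indicator g))
      (fun n => (hfm n).indicator hBm) hB.1 hB.norm
      (fun n => Eventually.of_forall fun y => by
        by_cases hy : y ∈ Metric.ball x r
        · rw [Set.indicator_of_mem hy, Set.indicator_of_mem hy]
          exact norm_indicator_le_norm_self _ _
        · rw [Set.indicator_of_notMem hy, Set.indicator_of_notMem hy])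
      (Eventually.of_forall fun y => le_rfl) (Eventually.of_forall fun y => by
        refine tendsto_const_nhds.congr' ?_
        obtain ⟨N₁, h1⟩ := exists_nat_gt ‖y‖
        obtain ⟨N₂, h2⟩ := exists_nat_ge ‖g y‖
        filter_upwards [eventually_ge_atTop N₁, eventually_ge_atTop N₂] with n hn1 hn2
        have hyA : y ∈ A n :=
          ⟨h1.trans_le (by exact_mod_cast hn1), h2.trans (by exact_mod_cast hn2)⟩
        by_cases hy : y ∈ Metric.ball x r
        · rw [Set.indicator_of_mem hy, Set.indicator_of_mem hy, Set.indicator_of_mem hyA]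
        · rw [Set.indicator_of_notMem hy, Set.indicator_of_notMem hy])
    refine h1.congr fun n => eLpNorm_congr_ae ?_
    refine EventuallyEq.sub ?_ (MorreySpace.coeFn_toLpBall hφ x hr g).symm
    filter_upwards [MorreySpace.coeFn_toLpBall hφ x hr (ι (v n)),
      MorreySpace.coeFn_ofFun _ (hfm n) (hfin n)] with y h1 h2
    rw [h1, hv]
    by_cases hy : y ∈ Metric.ball x r
    · rw [Set.indicator_of_mem hy, Set.indicator_of_mem hy]; exact h2.symm
    · rw [Set.indicator_of_notMem hy, Set.indicator_of_notMem hy]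
  let w : ℕ → WeakDual 𝕜 (StrongDual 𝕜 X) := fun n =>
    StrongDual.toWeakDual (NormedSpace.inclusionInDoubleDual 𝕜 X (v n))
  have hcpt := WeakDual.isCompact_closedBall (𝕜 := 𝕜)
    (0 : StrongDual 𝕜 (StrongDual 𝕜 X)) ‖g‖
  -- Banach–Alaoglu in `X**`. The limit is taken along an ultrafilter, so no sequential compactness
  -- is required, and convergence along `atTop` of the local integrals still identifies it.
  obtain ⟨Λ, hΛmem, hΛ⟩ := hcpt.ultrafilter_le_nhds ((hyperfilter ℕ).map w) (by
    rw [Ultrafilter.coe_map, le_principal_iff, mem_map]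
    refine univ_mem' fun n => ?_
    change NormedSpace.inclusionInDoubleDual 𝕜 X (v n) ∈
      Metric.closedBall 0 ‖g‖
    refine (mem_closedBall_zero_iff
      (a := NormedSpace.inclusionInDoubleDual 𝕜 X (v n))).2 ?_
    exact (NormedSpace.double_dual_bound 𝕜 _ (v n)).trans (hvn n))
  refine ⟨WeakDual.toStrongDual Λ, mem_closedBall_zero_iff.1 hΛmem, fun x r hr u => ?_⟩
  have ht : Tendsto w (hyperfilter ℕ) (𝓝 Λ) := hΛ
  have h1 := ((WeakDual.eval_continuous (ballDual ι hφ x hr u)).tendsto Λ).comp ht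
  have h2 := (((ContinuousLinearMap.mul 𝕜 𝕜).lpPairing volume (ENNReal.ofReal q)
    (ENNReal.ofReal p) u).continuous.tendsto _).comp ((hlim x r hr).mono_left
      Nat.hyperfilter_le_atTop)
  exact tendsto_nhds_unique h1 h2

end duality

/-! ### A countable family of dyadic lattice balls. -/

section lattice

variable {d : ℕ}

/-- The point `2^k m` of the scaled integer lattice. -/
noncomputable def latticePoint {d : ℕ} (i : ℤ × (Fin d → ℤ)) : Eucl d :=
  WithLp.toLp 2 fun j => (2 : ℝ) ^ i.1 * (i.2 j : ℝ)

/-- The radius `(d + 2) 2^k` of the balls around the points of the lattice of mesh `2^k`. -/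
noncomputable def latticeRadius {d : ℕ} (i : ℤ × (Fin d → ℤ)) : ℝ := ((d : ℝ) + 2) * (2 : ℝ) ^ i.1

theorem latticeRadius_pos (i : ℤ × (Fin d → ℤ)) : 0 < latticeRadius i := by
  unfold latticeRadius; positivity

/-- Rounding down each coordinate gives an error of at most `2^k` per coordinate, and `√d ≤ d + 1`.
-/
theorem exists_dist_latticePoint_le (x : Eucl d) (k : ℤ) :
    ∃ m : Fin d → ℤ, dist x (latticePoint (k, m)) ≤ ((d : ℝ) + 1) * (2 : ℝ) ^ k := by
  have h2 : (0 : ℝ) < 2 ^ k := by positivity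
  refine ⟨fun j => ⌊x j / 2 ^ k⌋, ?_⟩
  rw [dist_eq_norm]
  refine abs_le_of_sq_le_sq' ?_ (by positivity) |>.2
  rw [EuclideanSpace.norm_sq_eq]
  have hj : ∀ j, ‖(x - latticePoint (k, fun j => ⌊x j / 2 ^ k⌋)) j‖ ^ 2 ≤ ((2 : ℝ) ^ k) ^ 2 := by
    intro j
    refine pow_le_pow_left₀ (norm_nonneg _) ?_ 2
    change |x j - 2 ^ k * (⌊x j / 2 ^ k⌋ : ℝ)| ≤ _
    have e1 := Int.floor_le (x j / 2 ^ k)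
    have e2 := Int.lt_floor_add_one (x j / 2 ^ k)
    rw [le_div_iff₀ h2] at e1
    rw [div_lt_iff₀ h2] at e2
    rw [abs_le]
    constructor <;> nlinarith
  calc _ ≤ ∑ _j : Fin d, ((2 : ℝ) ^ k) ^ 2 := Finset.sum_le_sum fun j _ => hj j
    _ = (d : ℝ) * ((2 : ℝ) ^ k) ^ 2 := by simp
    _ ≤ ((d : ℝ) + 1) ^ 2 * ((2 : ℝ) ^ k) ^ 2 := by
      gcongr
      nlinarith [(Nat.cast_nonneg d : (0 : ℝ) ≤ d)]
    _ = _ := by ring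

/-- Each ball lies in a lattice ball of comparable radius and nearby centre. -/
theorem exists_ball_subset_latticeBall (x : Eucl d) {r : ℝ} (hr : 0 < r) :
    ∃ i : ℤ × (Fin d → ℤ), Metric.ball x r ⊆ Metric.ball (latticePoint i) (latticeRadius i) ∧
      dist (latticePoint i) x ≤ latticeRadius i ∧ r < latticeRadius i ∧
      latticeRadius i ≤ 2 * ((d : ℝ) + 2) * r := by
  -- With `2^n < r ≤ 2^(n+1)`, the lattice centre is within `(d+1) 2^(n+1)` of `x`. Adding `r`
  -- explains the radius `(d+2) 2^(n+1)`.
  obtain ⟨n, hn1, hn2⟩ := exists_mem_Ioc_zpow hr (one_lt_two : (1 : ℝ) < 2)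
  obtain ⟨m, hm⟩ := exists_dist_latticePoint_le x (n + 1)
  have h2 : (0 : ℝ) < 2 ^ (n + 1) := by positivity
  have hd : (0 : ℝ) ≤ d := Nat.cast_nonneg d
  have h3 : (2 : ℝ) ^ (n + 1) = 2 * 2 ^ n := by rw [zpow_add_one₀ two_ne_zero, mul_comm]
  refine ⟨(n + 1, m), Metric.ball_subset_ball' ?_, ?_, ?_, ?_⟩
  · unfold latticeRadius; simp only; linarith
  · rw [dist_comm]; unfold latticeRadius; simp only; linarith
  · unfold latticeRadius; simp only; nlinarith
  · unfold latticeRadius; simp only; rw [h3]; nlinarith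

/-- Only finitely many lattice balls of bounded scale meet a bounded set. -/
theorem finite_latticeBall {δ : ℝ} (hδ : 0 < δ) (ρ R : ℝ) :
    {i : ℤ × (Fin d → ℤ) | δ ≤ latticeRadius i ∧ latticeRadius i < ρ ∧
      ‖latticePoint i‖ < latticeRadius i + R}.Finite := by
  have hd : (0 : ℝ) < (d : ℝ) + 2 := by positivity
  rcases le_or_gt ρ 0 with hρ | hρ
  · refine Set.finite_empty.subset fun i hi => ?_
    exact absurd hi.2.1 (by linarith [latticeRadius_pos i])
  -- The bounds on the radius confine the exponent between `a` and `b + 1`; then `‖2^k m‖ < ρ + |R|`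
  -- with `2^k ≥ δ/(d+2)` bounds each coordinate of `m` by `N`.
  obtain ⟨a, ha, -⟩ := exists_mem_Ioc_zpow (div_pos hδ hd) (one_lt_two : (1 : ℝ) < 2)
  obtain ⟨b, -, hb⟩ := exists_mem_Ioc_zpow (div_pos hρ hd) (one_lt_two : (1 : ℝ) < 2)
  obtain ⟨N, hN⟩ := exists_nat_ge ((ρ + |R|) / (δ / ((d : ℝ) + 2)))
  refine ((Set.finite_Icc a (b + 1)).prod
    (Set.finite_Icc (fun _ : Fin d => -(N : ℤ)) (fun _ : Fin d => (N : ℤ)))).subset ?_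
  rintro ⟨k, m⟩ ⟨h1, h2, h3⟩
  have hk1 : δ / ((d : ℝ) + 2) ≤ 2 ^ k := by
    rw [div_le_iff₀ hd, mul_comm]; exact h1
  have hk2 : (2 : ℝ) ^ k < ρ / ((d : ℝ) + 2) := by
    rw [lt_div_iff₀ hd, mul_comm]; exact h2
  have hak : a < k := (zpow_lt_zpow_iff_right₀ (one_lt_two : (1 : ℝ) < 2)).1 (ha.trans_le hk1)
  have hkb : k < b + 1 :=
    (zpow_lt_zpow_iff_right₀ (one_lt_two : (1 : ℝ) < 2)).1 (hk2.trans_le hb)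
  have hm : ∀ j, |m j| ≤ (N : ℤ) := by
    intro j
    have e1 : |(2 : ℝ) ^ k * (m j : ℝ)| ≤ ‖latticePoint (k, m)‖ :=
      PiLp.norm_apply_le (latticePoint (k, m)) j
    have h2k : (0 : ℝ) < 2 ^ k := by positivity
    rw [abs_mul, abs_of_pos h2k] at e1
    have e2 : (2 : ℝ) ^ k * |(m j : ℝ)| ≤ ρ + |R| := by linarith [le_abs_self R]
    have e3 : |(m j : ℝ)| ≤ (ρ + |R|) / (δ / ((d : ℝ) + 2)) := by
      rw [le_div_iff₀ (by positivity), mul_comm]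
      exact (mul_le_mul_of_nonneg_right hk1 (abs_nonneg _)).trans e2
    exact_mod_cast e3.trans hN
  exact ⟨⟨hak.le, hkb.le⟩, fun j => (abs_le.1 (hm j)).1, fun j => (abs_le.1 (hm j)).2⟩

end lattice

/-! ### The embedding into a `c₀`-sum and density in the dual. -/

section lattice_operators

variable {d : ℕ} {𝕜 : Type*} [RCLike 𝕜] {p q : ℝ} [hp : Fact (1 ≤ p)]
  [Fact (1 ≤ ENNReal.ofReal p)] {φ : Eucl d → ℝ → ℝ}

/-- The normalized restriction to a lattice ball. -/
noncomputable def latticeOp (hφ : GDec p φ) (i : ℤ × (Fin d → ℤ)) :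
    MorreySpace 𝕜 p φ →L[𝕜] Lp 𝕜 (ENNReal.ofReal p) (volume : Measure (Eucl d)) :=
  (((ballWeight p φ (latticePoint i) (latticeRadius i)).toReal⁻¹ : ℝ) : 𝕜) •
    MorreySpace.toLpBall hφ (latticePoint i) (latticeRadius_pos i)

theorem norm_latticeOp (hφ : GDec p φ) (i : ℤ × (Fin d → ℤ)) (g : MorreySpace 𝕜 p φ) :
    ‖latticeOp hφ i g‖ = (meanP p g (latticePoint i) (latticeRadius i) /
      ENNReal.ofReal (φ (latticePoint i) (latticeRadius i))).toReal := by
  have hp0 : 0 < p := one_pos.trans_le hp.out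
  have hW : 0 < (ballWeight p φ (latticePoint i) (latticeRadius i)).toReal :=
    ENNReal.toReal_pos (ballWeight_ne_zero hφ _ (latticeRadius_pos i)) (ballWeight_ne_top hp0 _ _)
  have h1 := congrArg ENNReal.toReal
    (MorreySpace.enorm_toLpBall hφ (latticePoint i) (latticeRadius_pos i) g)
  rw [toReal_enorm, ENNReal.toReal_mul] at h1
  change ‖(((ballWeight p φ (latticePoint i) (latticeRadius i)).toReal⁻¹ : ℝ) : 𝕜) •
    MorreySpace.toLpBall hφ (latticePoint i) (latticeRadius_pos i) g‖ = _
  rw [norm_smul, RCLike.norm_ofReal, abs_of_pos (inv_pos.2 hW), h1]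
  field_simp

theorem norm_latticeOp_le (hφ : GDec p φ) (i : ℤ × (Fin d → ℤ)) (g : MorreySpace 𝕜 p φ) :
    ‖latticeOp hφ i g‖ ≤ ‖g‖ := by
  rw [norm_latticeOp, MorreySpace.norm_def]
  exact ENNReal.toReal_mono g.morreyENorm_lt_top.ne
    (meanP_div_le_morreyENorm _ _ (latticeRadius_pos i))

/-- The lattice balls determine the Morrey norm up to a constant. -/
theorem exists_norm_le_of_latticeOp (hφ : GDec p φ) (hNC : Nearness φ) :
    ∃ K : ℝ, ∀ (g : MorreySpace 𝕜 p φ) (a : ℝ), 0 ≤ a → (∀ i, ‖latticeOp hφ i g‖ ≤ a) →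
      ‖g‖ ≤ K * a := by
  have hp0 : 0 < p := one_pos.trans_le hp.out
  obtain ⟨C₁, hC₁, h₁⟩ := hφ.almost_mono
  obtain ⟨C₂, hC₂, h₂⟩ := hNC
  set b := (d : ℝ) / p with hb
  have hb0 : 0 ≤ b := by positivity
  refine ⟨(2 * ((d : ℝ) + 2)) ^ b * (C₂ * C₁), fun g a ha h => ?_⟩
  refine g.norm_le_of_morreyENorm_le (by positivity) ?_
  refine iSup_le fun x => iSup_le fun r => iSup_le fun hr => ?_
  obtain ⟨i, hsub, hdist, hlt, hle⟩ := exists_ball_subset_latticeBall x hr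
  have hi := latticeRadius_pos i
  have hφx := hφ.pos x r hr
  have hφi := hφ.pos x (latticeRadius i) hi
  have hmean : meanP p g (latticePoint i) (latticeRadius i) /
      ENNReal.ofReal (φ (latticePoint i) (latticeRadius i)) ≤ ENNReal.ofReal a := by
    have h3 := h i
    rw [norm_latticeOp] at h3
    exact ENNReal.le_ofReal_iff_toReal_le ((meanP_div_le_morreyENorm _ _ hi).trans_lt
      g.morreyENorm_lt_top).ne ha |>.2 h3
  -- Nearness moves the centre from the lattice point to `x`, almost decrease shrinks the radius to
  -- `r`, and the ratio of radii is at most `2(d+2)`.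
  have hweight : ballWeight p φ (latticePoint i) (latticeRadius i) ≤
      ENNReal.ofReal ((2 * ((d : ℝ) + 2)) ^ b * (C₂ * C₁)) * ballWeight p φ x r := by
    unfold ballWeight
    rw [mul_left_comm, ← ENNReal.ofReal_mul
      (by positivity : 0 ≤ (2 * ((d : ℝ) + 2)) ^ b * (C₂ * C₁))]
    refine mul_le_mul' le_rfl (ENNReal.ofReal_le_ofReal ?_)
    have e1 := (h₂ (latticePoint i) x (latticeRadius i) hi hdist).2
    rw [div_le_iff₀ hφi] at e1
    have e2 := (h₁ x r (latticeRadius i) hr hlt).2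
    have e3 : latticeRadius i ^ b ≤ (2 * ((d : ℝ) + 2)) ^ b * r ^ b := by
      rw [← Real.mul_rpow (by positivity) hr.le]
      exact Real.rpow_le_rpow hi.le hle hb0
    calc latticeRadius i ^ b * φ (latticePoint i) (latticeRadius i)
        ≤ ((2 * ((d : ℝ) + 2)) ^ b * r ^ b) * (C₂ * (C₁ * φ x r)) := by
          refine mul_le_mul e3 (e1.trans (by gcongr)) (hφ.pos _ _ hi).le (by positivity)
      _ = _ := by ring
  rw [meanP_div_eq hp0 hφ _ x hr, ← ballWeight]
  refine ENNReal.div_le_of_le_mul ?_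
  rw [← eLpNorm_indicator_eq_eLpNorm_restrict Metric.isOpen_ball.measurableSet]
  calc eLpNorm ((Metric.ball x r).indicator g) (ENNReal.ofReal p) volume
      ≤ eLpNorm ((Metric.ball (latticePoint i) (latticeRadius i)).indicator g)
        (ENNReal.ofReal p) volume := by
        refine eLpNorm_mono fun y => ?_
        exact norm_indicator_le_of_subset hsub _ y
    _ = _ := eLpNorm_ball_eq hp0 hφ _ _ hi
    _ ≤ ENNReal.ofReal a *
        (ENNReal.ofReal ((2 * ((d : ℝ) + 2)) ^ b * (C₂ * C₁)) * ballWeight p φ x r) := by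
        gcongr
    _ = _ := by
        rw [← mul_assoc, mul_comm (ENNReal.ofReal a), ← ENNReal.ofReal_mul (by positivity)]

/-- For elements of the closure of the test functions, the lattice means tend to zero. -/
theorem tendsto_latticeOp (hφ : GDec p φ) (hNC : Nearness φ)
    (hlim1 : SmallScaleLim φ) (hlim2 : LargeScaleLim p φ) {g : MorreySpace 𝕜 p φ}
    (hg : g ∈ morreyClosure 𝕜 p φ) :
    Tendsto (fun i => latticeOp hφ i g) cofinite (𝓝 0) := by
  have hp0 : 0 < p := one_pos.trans_le hp.out
  rw [tendsto_zero_iff_norm_tendsto_zero]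
  refine tendsto_order.2 ⟨fun a ha => Eventually.of_forall fun i => ha.trans_le (norm_nonneg _),
    fun ε hε => ?_⟩
  -- All the lattice operators are contractions, so it suffices to treat a test function `t` within
  -- `ε/2` of `g`.
  obtain ⟨t, ⟨h, hsm, hcs, hth⟩, hgt⟩ := Metric.mem_closure_iff.1 hg (ε / 2) (half_pos hε)
  obtain ⟨K, hK⟩ := hcs.exists_bound_of_continuous hsm.continuous
  obtain ⟨R, hR⟩ := hcs.isBounded.subset_ball (0 : Eucl d)
  have hK0 : 0 ≤ K := (norm_nonneg _).trans (hK 0)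
  have htK : ∀ᵐ y, ‖t y‖ₑ ≤ ENNReal.ofReal K := by
    filter_upwards [hth] with y hy
    rw [hy, ← ofReal_norm]; exact ENNReal.ofReal_le_ofReal (hK y)
  have htR : ∀ᵐ y, y ∉ Metric.ball (0 : Eucl d) R → t y = 0 := by
    filter_upwards [hth] with y hy hyR
    rw [hy]; exact image_eq_zero_of_notMem_tsupport fun h => hyR (hR h)
  have htp : eLpNorm t (ENNReal.ofReal p) volume ≠ ⊤ := by
    rw [eLpNorm_congr_ae hth]
    exact (hsm.continuous.memLp_of_hasCompactSupport hcs).2.ne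
  set W₀ := volume (Metric.ball (0 : Eucl d) 1) ^ (1 / p) with hW₀
  have hW0 : W₀ ≠ 0 := volume_unitBall_rpow_pos.ne'
  set T := (eLpNorm t (ENNReal.ofReal p) volume / W₀).toReal with hT
  have hTtop : eLpNorm t (ENNReal.ofReal p) volume / W₀ ≠ ⊤ := ENNReal.div_ne_top htp hW0
  have hT0 : 0 ≤ T := ENNReal.toReal_nonneg
  -- Below radius `δ` the supremum `K` gives quotients under `ε/2`; above `ρ` the normalized `L^p`
  -- norm `T` does. Only finitely many lattice balls between these scales meet the support. The `+
  -- 1` covers `K = 0` and `T = 0` and makes the inequalities strict.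
  obtain ⟨δ, hδ, hsmall⟩ := hlim1.exists_le hφ R ((K + 1) / (ε / 2))
  obtain ⟨ρ, hρ, hlarge⟩ := hlim2.exists_le hφ hNC R ((T + 1) / (ε / 2))
  have quot : ∀ s : ℝ, 0 ≤ s → s / ((s + 1) / (ε / 2)) < ε / 2 := fun s hs => by
    rw [div_div_eq_mul_div, div_lt_iff₀ (by positivity)]
    nlinarith
  have key : ∀ᶠ i in cofinite, ‖latticeOp hφ i t‖ < ε / 2 := by
    filter_upwards [(finite_latticeBall (d := d) hδ ρ R).compl_mem_cofinite] with i hi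
    have hri := latticeRadius_pos i
    rw [norm_latticeOp]
    rcases le_or_gt (latticeRadius i + R) ‖latticePoint i‖ with h1 | h1
    · rw [meanP_eq_zero_of_disjoint hp0 htR h1, ENNReal.zero_div, ENNReal.toReal_zero]
      exact half_pos hε
    rcases lt_or_ge (latticeRadius i) δ with h2 | h2
    · have h3 := hsmall _ _ hri h2 h1
      have h4 : meanP p t (latticePoint i) (latticeRadius i) /
          ENNReal.ofReal (φ (latticePoint i) (latticeRadius i)) ≤
          ENNReal.ofReal (K / ((K + 1) / (ε / 2))) := by
        rw [ENNReal.ofReal_div_of_pos (by positivity)]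
        exact ENNReal.div_le_div (meanP_le_of_ae_le hp0 htK _ hri) (ENNReal.ofReal_le_ofReal h3)
      exact (ENNReal.toReal_le_of_le_ofReal (by positivity) h4).trans_lt (quot K hK0)
    · have h2' : ρ ≤ latticeRadius i := by
        by_contra hlt
        exact hi ⟨h2, not_le.1 hlt, h1⟩
      have h3 := hlarge _ _ h2' h1
      have h4 : meanP p t (latticePoint i) (latticeRadius i) /
          ENNReal.ofReal (φ (latticePoint i) (latticeRadius i)) ≤
          ENNReal.ofReal (T / ((T + 1) / (ε / 2))) := by
        rw [ENNReal.ofReal_div_of_pos (by positivity), hT, ENNReal.ofReal_toReal hTtop, ← hT,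
          meanP_div_eq hp0 hφ _ _ hri, ← hW₀]
        refine (ENNReal.div_le_div (eLpNorm_mono_measure _ Measure.restrict_le_self)
          (mul_le_mul' le_rfl (ENNReal.ofReal_le_ofReal h3))).trans_eq ?_
        simp only [div_eq_mul_inv]
        rw [ENNReal.mul_inv (Or.inl hW0) (Or.inl (volume_unitBall_rpow_ne_top hp0)), mul_assoc]
      exact (ENNReal.toReal_le_of_le_ofReal (by positivity) h4).trans_lt (quot T hT0)
  filter_upwards [key] with i hi
  have h1 : latticeOp hφ i g = latticeOp hφ i (g - t) + latticeOp hφ i t := by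
    rw [← map_add, sub_add_cancel]
  rw [h1]
  rw [dist_eq_norm] at hgt
  linarith [norm_add_le (latticeOp hφ i (g - t)) (latticeOp hφ i t),
    norm_latticeOp_le hφ i (g - t)]

variable [Fact (1 ≤ ENNReal.ofReal q)]
  [ENNReal.HolderConjugate (ENNReal.ofReal q) (ENNReal.ofReal p)]
  {X : Type*} [NormedAddCommGroup X] [NormedSpace 𝕜 X] (ι : X →ₗᵢ[𝕜] MorreySpace 𝕜 p φ)

/-- A functional on the dual that vanishes on the functionals given by `L^q` functions of bounded
support is zero. -/
theorem eq_zero_of_represents_zero (hφ : GDec p φ) (hpq : p.HolderConjugate q) (hNC : Nearness φ)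
    (hlim1 : SmallScaleLim φ) (hlim2 : LargeScaleLim p φ)
    (hι : ∀ v, ι v ∈ morreyClosure 𝕜 p φ) {Λ : StrongDual 𝕜 (StrongDual 𝕜 X)}
    (hΛ : Represents ι q hφ Λ 0) : Λ = 0 := by
  obtain ⟨K, hK⟩ := exists_norm_le_of_latticeOp (𝕜 := 𝕜) hφ hNC
  have hzero : ∀ (x : Eucl d) (r : ℝ) (hr : 0 < r)
      (u : Lp 𝕜 (ENNReal.ofReal q) (volume : Measure (Eucl d))), Λ (ballDual ι hφ x hr u) = 0 :=
    fun x r hr u => by rw [hΛ x r hr u, map_zero, map_zero]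
  ext ℓ
  have hsmall : ∀ ε : ℝ, 0 < ε → ‖Λ ℓ‖ ≤ ‖Λ‖ * ε := by
    intro ε hε
    obtain ⟨S, lam, hS⟩ := exists_sum_comp_approx
      (fun i => (latticeOp hφ i).comp ι.toContinuousLinearMap) 1
      (fun i v => by
        rw [one_mul, ← ι.norm_map v]
        exact norm_latticeOp_le hφ i (ι v))
      (fun v => tendsto_latticeOp hφ hNC hlim1 hlim2 (hι v)) K
      (fun v a ha h => by
        rw [← ι.norm_map v]
        exact hK (ι v) a ha h) ℓ hε
    -- By `L^p` duality, a functional factoring through restriction to a ball is integration against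
    -- an `L^q` function on that ball, where `Λ` vanishes.
    have hlam : ∀ i, Λ ((lam i).comp ((latticeOp hφ i).comp ι.toContinuousLinearMap)) = 0 := by
      intro i
      obtain ⟨w, -, hw⟩ := exists_lpPairing_eq hpq (lam i)
      have h1 : (lam i).comp ((latticeOp hφ i).comp ι.toContinuousLinearMap) =
          ballDual ι hφ (latticePoint i) (latticeRadius_pos i)
            ((((ballWeight p φ (latticePoint i) (latticeRadius i)).toReal⁻¹ : ℝ) : 𝕜) • w) := by
        ext v
        rw [map_smul, ← hw]
        exact ContinuousLinearMap.map_smul ((ContinuousLinearMap.mul 𝕜 𝕜).lpPairing volume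
          (ENNReal.ofReal q) (ENNReal.ofReal p) w) _ _
      exact (congrArg Λ h1).trans (hzero _ _ _ _)
    have h2 : Λ (ℓ - ∑ i ∈ S, (lam i).comp ((latticeOp hφ i).comp ι.toContinuousLinearMap)) =
        Λ ℓ := by
      rw [map_sub, map_sum, Finset.sum_eq_zero fun i _ => hlam i, sub_zero]
    rw [← h2]
    exact (Λ.le_opNorm _).trans (mul_le_mul_of_nonneg_left hS (norm_nonneg Λ))
  have h3 : ‖Λ ℓ‖ ≤ 0 := by
    refine le_of_forall_pos_le_add fun ε hε => ?_
    have h4 := hsmall (ε / (‖Λ‖ + 1)) (by have := norm_nonneg Λ; positivity)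
    have h5 : ‖Λ‖ * (ε / (‖Λ‖ + 1)) ≤ ε := by
      have := norm_nonneg Λ
      rw [mul_div_assoc', div_le_iff₀ (by positivity)]
      nlinarith
    linarith
  exact norm_le_zero_iff.1 h3

end lattice_operators

/-! ### The isometry onto the bidual. -/

section bidual

variable {d : ℕ} {𝕜 : Type*} [RCLike 𝕜] {p q : ℝ} [hp : Fact (1 ≤ p)]
  [Fact (1 ≤ ENNReal.ofReal p)] [Fact (1 ≤ ENNReal.ofReal q)]
  [ENNReal.HolderConjugate (ENNReal.ofReal q) (ENNReal.ofReal p)] {φ : Eucl d → ℝ → ℝ}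

section

variable {X : Type*} [NormedAddCommGroup X] [NormedSpace 𝕜 X] (ι : X →ₗᵢ[𝕜] MorreySpace 𝕜 p φ)

/-- The isometry of the Morrey space onto the bidual of the closure of the test functions. -/
theorem exists_isometry_bidual (hφ : GDec p φ) (hpq : p.HolderConjugate q) (hNC : Nearness φ)
    (hlim1 : SmallScaleLim φ) (hlim2 : LargeScaleLim p φ)
    (hι : ∀ g, g ∈ morreyClosure 𝕜 p φ ↔ ∃ v, ι v = g) :
    ∃ T : MorreySpace 𝕜 p φ ≃L[𝕜] StrongDual 𝕜 (StrongDual 𝕜 X),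
      (∀ v, T (ι v) = NormedSpace.inclusionInDoubleDual 𝕜 X v) ∧
      ∀ g, Represents ι q hφ (T g) g := by
  choose T hTn hT using exists_represented ι hφ hpq hNC hlim1 hlim2 hι
  -- Uniqueness makes the arbitrary choice `T` linear, onto, and equal to the canonical embedding on
  -- `X`: in each case two functionals are represented by the same function.
  have huniq : ∀ (Λ₁ Λ₂ : StrongDual 𝕜 (StrongDual 𝕜 X)) (g : MorreySpace 𝕜 p φ),
      Represents ι q hφ Λ₁ g → Represents ι q hφ Λ₂ g → Λ₁ = Λ₂ := by
    intro Λ₁ Λ₂ g h₁ h₂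
    have h : Represents ι q hφ (Λ₁ - Λ₂) 0 := fun x r hr u => by
      rw [map_zero, map_zero]
      exact sub_eq_zero.2 ((h₁ x r hr u).trans (h₂ x r hr u).symm)
    exact sub_eq_zero.1 (eq_zero_of_represents_zero ι hφ hpq hNC hlim1 hlim2
      (fun v => (hι _).2 ⟨v, rfl⟩) h)
  let T₁ : MorreySpace 𝕜 p φ →ₗᵢ[𝕜] StrongDual 𝕜 (StrongDual 𝕜 X) :=
    { toFun := T
      map_add' := fun g₁ g₂ => huniq _ _ _ (hT (g₁ + g₂)) ((hT g₁).add (hT g₂))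
      map_smul' := fun c g => huniq _ _ _ (hT (c • g)) ((hT g).smul c)
      norm_map' := fun g => le_antisymm (hTn g) ((hT g).norm_le hpq) }
  have hsurj : Function.Surjective T₁ := fun Λ => by
    obtain ⟨g, hg⟩ := exists_represents ι hφ hpq Λ
    exact ⟨g, huniq _ _ _ (hT g) hg⟩
  refine ⟨(LinearIsometryEquiv.ofSurjective T₁ hsurj).toContinuousLinearEquiv, fun v => ?_, hT⟩
  exact huniq _ _ _ (hT (ι v)) (represents_inclusionInDoubleDual ι hφ v)

end

/-- The product of an `L^q` function supported in a ball with an element of the Morrey space. -/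
theorem integrable_mul_and_integral_eq (hφ : GDec p φ) {f : Eucl d → 𝕜}
    (hf : MemLp f (ENNReal.ofReal q) volume) {r : ℝ} (hr : 0 < r)
    (hfr : ∀ y, y ∉ Metric.ball (0 : Eucl d) r → f y = 0) (g : MorreySpace 𝕜 p φ) :
    Integrable (fun x => f x * g x) volume ∧
      (ContinuousLinearMap.mul 𝕜 𝕜).lpPairing volume (ENNReal.ofReal q) (ENNReal.ofReal p)
        (hf.toLp f) (MorreySpace.toLpBall hφ 0 hr g) = ∫ x, f x * g x := by
  have h1 : ∀ y, f y * (Metric.ball (0 : Eucl d) r).indicator g y = f y * g y := fun y => by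
    by_cases hy : y ∈ Metric.ball (0 : Eucl d) r
    · rw [Set.indicator_of_mem hy]
    · rw [hfr y hy, zero_mul, zero_mul]
  constructor
  · have h2 : Integrable (f * (Metric.ball (0 : Eucl d) r).indicator g) volume :=
      hf.integrable_mul (g.memLp_indicator_ball hφ 0 hr)
    exact h2.congr (Eventually.of_forall h1)
  · rw [lpPairing_mul_apply]
    refine integral_congr_ae ?_
    filter_upwards [hf.coeFn_toLp, MorreySpace.coeFn_toLpBall hφ 0 hr g] with y h2 h3
    rw [h2, h3, h1]

end bidual

theorem mainTheorem3 {d : ℕ} {𝕜 : Type*} [RCLike 𝕜] (p q : ℝ) [Fact (1 ≤ p)]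
    (hp : 1 < p) (hq : 1 < q) (hpq : 1 / p + 1 / q = 1)
    (φ : Eucl d → ℝ → ℝ) (hφ : GDec p φ) (hNC : Nearness φ)
    (hlim1 : SmallScaleLim φ) (hlim2 : LargeScaleLim p φ) :
    (∀ h : Eucl d → 𝕜, ContDiff ℝ ∞ h → HasCompactSupport h → morreyENorm p φ h < ⊤) ∧
    ∃ T : MorreySpace 𝕜 p φ ≃L[𝕜] StrongDual 𝕜 (StrongDual 𝕜 (morreyClosure 𝕜 p φ)),
      (∀ v : morreyClosure 𝕜 p φ,
        T (v : MorreySpace 𝕜 p φ) =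
          NormedSpace.inclusionInDoubleDual 𝕜 (morreyClosure 𝕜 p φ) v) ∧
      (∀ f : Eucl d → 𝕜, MemLp f (ENNReal.ofReal q) volume → HasCompactSupport f →
        (∀ g : MorreySpace 𝕜 p φ,
          Integrable (fun x => f x * g x) volume) ∧
        ∃ ℓ : StrongDual 𝕜 (morreyClosure 𝕜 p φ),
          (∀ v : morreyClosure 𝕜 p φ,
            ℓ v = ∫ x, f x * (v : MorreySpace 𝕜 p φ) x) ∧
          ∀ g : MorreySpace 𝕜 p φ,
            T g ℓ = ∫ x, f x * g x) := by
  have hconj : p.HolderConjugate q :=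
    Real.holderConjugate_iff.2 ⟨hp, by simpa [one_div] using hpq⟩
  have : Fact (1 ≤ ENNReal.ofReal p) := ⟨by simpa using hp.le⟩
  have : Fact (1 ≤ ENNReal.ofReal q) := ⟨by simpa using hq.le⟩
  have : ENNReal.HolderConjugate (ENNReal.ofReal q) (ENNReal.ofReal p) :=
    hconj.symm.ennrealOfReal
  refine ⟨fun h hc hs => morreyENorm_lt_top_of_contDiff hconj.pos hφ hNC hlim1 hlim2
    hc.continuous hs, ?_⟩
  let ι : morreyClosure 𝕜 p φ →ₗᵢ[𝕜] MorreySpace 𝕜 p φ := (morreyClosure 𝕜 p φ).subtypeₗᵢ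
  obtain ⟨T, hT₁, hT₂⟩ := exists_isometry_bidual ι hφ hconj hNC hlim1 hlim2
    (fun g => ⟨fun hg => ⟨⟨g, hg⟩, rfl⟩, by rintro ⟨v, rfl⟩; exact v.2⟩)
  refine ⟨T, hT₁, fun f hf hfs => ?_⟩
  -- A centred ball containing the support of `f` turns integration against `f` into a `ballDual`
  -- functional, so the formula for `T g` is the representation property on that ball.
  obtain ⟨r, hr, hsub⟩ := hfs.isBounded.subset_ball_lt 0 (0 : Eucl d)
  have key := fun g : MorreySpace 𝕜 p φ => integrable_mul_and_integral_eq hφ hf hr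
    (fun y hy => image_eq_zero_of_notMem_tsupport fun h => hy (hsub h)) g
  exact ⟨fun g => (key g).1, ballDual ι hφ 0 hr (hf.toLp f), fun v => (key v).2,
    fun g => (hT₂ g 0 r hr (hf.toLp f)).trans (key g).2⟩
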